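/- Conventions. Let $\mathcal H$ be a complex Hilbert space. A densely defined operator $(K,D(K))$ in $\mathcal H$ is *maximal accretive* if $\mathrm{Re}\,\langle u,Ku\rangle\ge 0$ for all $u\in D(K)$ and $1+K:D(K)\to\mathcal H$ is a bijection. Let $(\Lambda,D(\Lambda))$ be a self-adjoint operator with $\Lambda\ge 1$ and let $r\in(0,1]$. A maximal accretive operator $(K,D(K))$ is *$(\Lambda,r)$-cuspidal* if $D(\Lambda)$ is contained in $D(K)$ and dense in it for the graph norm, and if there is a constant $C>0$ such that $$\forall u\in D(\Lambda),\quad \|Ku\|\le C\|\Lambda u\|,$$ $$\forall u\in D(\Lambda),\ \forall\lambda\in\mathbb R,\quad \|\Lambda^{r}u\|\le C\left[\|(K-i\lambda)u\|+\|u\|\right].$$ **Proposition.** Let $\mathcal H_1,\mathcal H_2$ be complex Hilbert spaces with Hilbert tensor product $\mathcal H_1\otimes\mathcal H_2$. Assume that $(K_1,D(K_1))$ is $(\Lambda_1,r_1)$-cuspidal in $\mathcal H_1$ and that $(K_2,D(K_2))$ is $(\Lambda_2,r_2)$-cuspidal in $\mathcal H_2$. Let $K$ be the closure of $K_1\otimes\mathrm{Id}_{\mathcal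 H_2}+\mathrm{Id}_{\mathcal H_1}\otimes K_2$ initially defined on the algebraic tensor product $D(K_1)\otimes^{\mathrm{alg}}D(K_2)$, and let $\Lambda$ be the closure of $\Lambda_1\otimes\mathrm{Id}_{\mathcal H_2}+\mathrm{Id}_{\mathcal H_1}\otimes\Lambda_2$ initially defined on $D(\Lambda_1)\otimes^{\mathrm{alg}}D(\Lambda_2)$. Then $K$ is $(\Lambda,r)$-cuspidal (in particular, $K$ is maximal accretive and $\Lambda$ is self-adjoint with $\Lambda\ge 1$) for every real $r$ with $$0<r<\min\left\{\frac{r_1^2}{8-2r_1},\frac{r_2^2}{8-2r_2}\right\}.$$ -/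

import Mathlib

open scoped TensorProduct InnerProductSpace

namespace CuspidalOperator

section Single

variable {H : Type*} [NormedAddCommGroup H] [InnerProductSpace ℂ H] [CompleteSpace H]

/-- A densely defined operator `(K, D(K))` in a complex Hilbert space is maximal accretive if
`Re ⟨u, K u⟩ ≥ 0` for all `u ∈ D(K)` and `1 + K : D(K) → H` is a bijection. -/
structure IsMaximalAccretive (K : H →ₗ.[ℂ] H) : Prop where
  dense_domain : Dense (K.domain : Set H)
  accretive : ∀ u : K.domain, 0 ≤ (⟪(u : H), K u⟫_ℂ).re
  bijective : Function.Bijective (fun u : K.domain => (u : H) + K u)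

/-- `(Λ, D(Λ))` is self-adjoint (as an unbounded operator) and `Λ ≥ 1` in the sense of
quadratic forms. -/
structure IsSelfAdjointGeOne (L : H →ₗ.[ℂ] H) : Prop where
  selfAdjoint : IsSelfAdjoint L
  one_le : ∀ u : L.domain, ‖(u : H)‖ ^ 2 ≤ (⟪(u : H), L u⟫_ℂ).re

/-- `B` is an everywhere defined bounded inverse of the unbounded operator `T`:
`x ∈ D(T)` and `T x = y` if and only if `x = B y`. -/
def IsBoundedInverse (T : H →ₗ.[ℂ] H) (B : H →L[ℂ] H) : Prop :=
  ∀ x y : H, (x, y) ∈ T.graph ↔ B y = x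

open Classical in
/-- The bounded inverse `T⁻¹` of an unbounded operator `T`, if it exists (and `0` otherwise).
It exists for a self-adjoint `T ≥ 1`, see `isBoundedInverse_boundedInverse`. -/
noncomputable def boundedInverse (T : H →ₗ.[ℂ] H) : H →L[ℂ] H :=
  if h : ∃ B : H →L[ℂ] H, IsBoundedInverse T B then h.choose else 0

/-- The fractional power `Λ ^ s`, `s > 0`, of a self-adjoint operator `Λ ≥ 1`. It is the inverse
of the bounded injective operator `Λ ^ (-s) = (Λ⁻¹) ^ s`, where the right-hand side is given by
the continuous functional calculus of the bounded nonnegative operator `Λ⁻¹`. So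
`D(Λ ^ s)` is the range of `(Λ⁻¹) ^ s`. -/
noncomputable def rpow (L : H →ₗ.[ℂ] H) (s : ℝ) : H →ₗ.[ℂ] H :=
  (((boundedInverse L ^ s : H →L[ℂ] H) : H →ₗ[ℂ] H).toPMap ⊤).inverse

theorem IsSelfAdjointGeOne.symm {L : H →ₗ.[ℂ] H} (hL : IsSelfAdjointGeOne L)
    (u v : L.domain) : ⟪L u, (v : H)⟫_ℂ = ⟪(u : H), L v⟫_ℂ := by
  have h := LinearPMap.adjoint_isFormalAdjoint hL.selfAdjoint.dense_domain
  have h2 : L.adjoint = L := hL.selfAdjoint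
  rw [h2] at h
  exact h u v

theorem IsSelfAdjointGeOne.norm_le {L : H →ₗ.[ℂ] H} (hL : IsSelfAdjointGeOne L)
    (u : L.domain) : ‖(u : H)‖ ≤ ‖L u‖ := by
  have h1 := hL.one_le u
  have h2 : (⟪(u : H), L u⟫_ℂ).re ≤ ‖(u : H)‖ * ‖L u‖ := re_inner_le_norm (𝕜 := ℂ) _ _
  by_contra! h
  have h3 : 0 < ‖(u : H)‖ := (norm_nonneg _).trans_lt h
  nlinarith

theorem IsSelfAdjointGeOne.surjective {L : H →ₗ.[ℂ] H} (hL : IsSelfAdjointGeOne L) :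
    Function.Surjective L := by
  have hcl : IsClosed (L.graph : Set (H × H)) := hL.selfAdjoint.isClosed
  have hclosed : IsClosed (LinearMap.range L.toFun : Set H) := by
    rw [← isSeqClosed_iff_isClosed]
    intro y z hy hyz
    choose u hu using hy
    have hc : CauchySeq fun n => (u n : H) := by
      have hyc := hyz.cauchySeq
      rw [Metric.cauchySeq_iff] at hyc ⊢
      intro ε hε
      obtain ⟨N, hN⟩ := hyc ε hε
      refine ⟨N, fun m hm n hn => lt_of_le_of_lt ?_ (hN m hm n hn)⟩
      rw [dist_eq_norm, dist_eq_norm, ← hu m, ← hu n, ← map_sub]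
      exact hL.norm_le (u m - u n)
    obtain ⟨x, hx⟩ := cauchySeq_tendsto_of_complete hc
    have hmem : (x, z) ∈ L.graph := by
      refine hcl.mem_of_tendsto (hx.prodMk_nhds hyz) (Filter.Eventually.of_forall fun n => ?_)
      rw [← hu n]
      exact L.mem_graph (u n)
    obtain ⟨w, -, hw⟩ := (L.mem_graph_iff).1 hmem
    exact ⟨w, hw⟩
  have hperp : (LinearMap.range L.toFun)ᗮ = ⊥ := by
    rw [Submodule.eq_bot_iff]
    intro w hw
    have hz : ∀ x : L.domain, ⟪(0 : H), (x : H)⟫_ℂ = ⟪w, L x⟫_ℂ := fun x => by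
      rw [inner_zero_left]
      exact ((Submodule.mem_orthogonal' _ _).1 hw _ ⟨x, rfl⟩).symm
    have hwd : w ∈ L.adjoint.domain := LinearPMap.mem_adjoint_domain_of_exists w ⟨0, hz⟩
    have h0 : L.adjoint ⟨w, hwd⟩ = 0 :=
      LinearPMap.adjoint_apply_eq hL.selfAdjoint.dense_domain ⟨w, hwd⟩ hz
    have hg : (w, (0 : H)) ∈ L.adjoint.graph := by
      rw [← h0]; exact L.adjoint.mem_graph ⟨w, hwd⟩
    have h2 : L.adjoint = L := hL.selfAdjoint
    rw [h2] at hg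
    obtain ⟨v, hv, hv0⟩ := (L.mem_graph_iff).1 hg
    have := hL.norm_le v
    rw [hv0, norm_zero] at this
    have hw0 : (v : H) = 0 := norm_le_zero_iff.1 this
    exact hv.symm.trans hw0
  have htop : LinearMap.range L.toFun = ⊤ := by
    rw [← hclosed.submodule_topologicalClosure_eq]
    exact Submodule.topologicalClosure_eq_top_iff.2 hperp
  exact LinearMap.range_eq_top.1 htop

theorem isBoundedInverse_boundedInverse {L : H →ₗ.[ℂ] H} (hL : IsSelfAdjointGeOne L) :
    IsBoundedInverse L (boundedInverse L) := by
  have hex : ∃ B : H →L[ℂ] H, IsBoundedInverse L B := by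
    have hinj : Function.Injective L.toFun := by
      rw [injective_iff_map_eq_zero]
      intro u hu
      have := hL.norm_le u
      rw [show L u = 0 from hu, norm_zero] at this
      exact Subtype.ext (norm_le_zero_iff.1 this)
    let e : L.domain ≃ₗ[ℂ] H := LinearEquiv.ofBijective L.toFun ⟨hinj, hL.surjective⟩
    have he : ∀ u, e u = L u := fun _ => rfl
    refine ⟨(L.domain.subtype ∘ₗ e.symm.toLinearMap).mkContinuous 1 fun y => ?_, fun x y => ?_⟩
    · have := hL.norm_le (e.symm y)
      rw [← he, e.apply_symm_apply] at this
      simpa using this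
    · rw [LinearPMap.mem_graph_iff]
      constructor
      · rintro ⟨u, rfl, rfl⟩
        rw [← he]
        simp
      · intro h
        refine ⟨e.symm y, by simpa using h, ?_⟩
        rw [← he, e.apply_symm_apply]
  rw [boundedInverse, dif_pos hex]
  exact hex.choose_spec

theorem boundedInverse_nonneg {L : H →ₗ.[ℂ] H} (hL : IsSelfAdjointGeOne L) :
    0 ≤ boundedInverse L := by
  have hB := isBoundedInverse_boundedInverse hL
  have key : ∀ y, ∃ u : L.domain, boundedInverse L y = u ∧ L u = y := fun y => by
    obtain ⟨u, hu, hu'⟩ := (L.mem_graph_iff).1 ((hB _ y).2 rfl)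
    exact ⟨u, hu.symm, hu'⟩
  rw [ContinuousLinearMap.nonneg_iff_isPositive, ContinuousLinearMap.isPositive_iff]
  constructor
  · intro x y
    obtain ⟨u, hu, rfl⟩ := key x
    obtain ⟨v, hv, rfl⟩ := key y
    change ⟪boundedInverse L (L u), L v⟫_ℂ = ⟪L u, boundedInverse L (L v)⟫_ℂ
    rw [hu, hv, hL.symm]
  · intro x
    obtain ⟨u, hu, rfl⟩ := key x
    rw [hu]
    have h1 := (sq_nonneg ‖(u : H)‖).trans (hL.one_le u)
    have h2 : (starRingEnd ℂ) ⟪(u : H), L u⟫_ℂ = ⟪(u : H), L u⟫_ℂ := by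
      rw [inner_conj_symm, hL.symm]
    rw [Complex.conj_eq_iff_im] at h2
    exact Complex.nonneg_iff.2 ⟨h1, h2.symm⟩

theorem boundedInverse_injective {L : H →ₗ.[ℂ] H} (hL : IsSelfAdjointGeOne L) :
    Function.Injective (boundedInverse L) := by
  have hB := isBoundedInverse_boundedInverse hL
  rw [injective_iff_map_eq_zero]
  intro y hy
  obtain ⟨u, hu, hu'⟩ := (L.mem_graph_iff).1 ((hB _ y).2 hy)
  have hu0 : u = 0 := Subtype.ext hu
  rw [hu0, LinearPMap.map_zero] at hu'
  exact hu'.symm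

theorem boundedInverse_eq_mul {L : H →ₗ.[ℂ] H} (hL : IsSelfAdjointGeOne L) {s : ℝ}
    (h0 : 0 < s) (h1 : s < 1) :
    boundedInverse L = boundedInverse L ^ s * boundedInverse L ^ (1 - s) := by
  have hs : (0 : NNReal) < ⟨s, h0.le⟩ := h0
  have hs' : (0 : NNReal) < ⟨1 - s, by linarith⟩ := by
    change 0 < 1 - s
    linarith
  have h := CFC.nnrpow_add (a := boundedInverse L) hs hs'
  rw [CFC.nnrpow_eq_rpow hs, CFC.nnrpow_eq_rpow hs', CFC.nnrpow_eq_rpow (add_pos hs hs')] at h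
  have h2 : (((⟨s, h0.le⟩ + ⟨1 - s, by linarith⟩ : NNReal)) : ℝ) = 1 := by
    change s + (1 - s) = 1
    ring
  rw [h2, CFC.rpow_one _ (boundedInverse_nonneg hL)] at h
  exact h

/-- For `0 < s ≤ 1` the bounded operator `(Λ⁻¹) ^ s` is injective, so its inverse `Λ ^ s`
is an operator. -/
theorem ker_boundedInverse_rpow {L : H →ₗ.[ℂ] H} (hL : IsSelfAdjointGeOne L) {s : ℝ}
    (h0 : 0 < s) (h1 : s ≤ 1) :
    (((boundedInverse L ^ s : H →L[ℂ] H) : H →ₗ[ℂ] H).toPMap ⊤).toFun.ker = ⊥ := by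
  rw [LinearMap.ker_eq_bot']
  intro x hx
  have hx' : (boundedInverse L ^ s) (x : H) = 0 := hx
  refine Subtype.ext (boundedInverse_injective hL ?_)
  rcases h1.lt_or_eq with h1 | rfl
  · have h := boundedInverse_eq_mul hL (s := 1 - s) (by linarith) (by linarith)
    rw [sub_sub_cancel] at h
    rw [h, mul_apply_eq_comp, hx']
    simp
  · rw [CFC.rpow_one _ (boundedInverse_nonneg hL)] at hx'
    simpa using hx'

/-- `(x, y)` lies in the graph of `Λ ^ s` if and only if `x = (Λ⁻¹) ^ s y`. -/
theorem mem_graph_rpow_iff {L : H →ₗ.[ℂ] H} (hL : IsSelfAdjointGeOne L) {s : ℝ}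
    (h0 : 0 < s) (h1 : s ≤ 1) (x y : H) :
    (x, y) ∈ (rpow L s).graph ↔ (boundedInverse L ^ s) y = x := by
  rw [rpow, LinearPMap.inverse_graph (ker_boundedInverse_rpow hL h0 h1)]
  generalize boundedInverse L ^ s = A
  constructor
  · rintro ⟨⟨a, b⟩, hab, h⟩
    obtain ⟨u, hu, hu'⟩ := (LinearPMap.mem_graph_iff _).1 hab
    obtain ⟨rfl, rfl⟩ := Prod.ext_iff.1 h
    change (u : H) = a at hu
    change A (u : H) = b at hu'
    change A a = b
    rw [← hu, hu']
  · intro h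
    exact ⟨(y, x), (LinearPMap.mem_graph_iff _).2 ⟨⟨y, trivial⟩, rfl, h⟩, rfl⟩

/-- `D(Λ) ⊆ D(Λ ^ s)` for `0 < s ≤ 1`. -/
theorem domain_le_domain_rpow {L : H →ₗ.[ℂ] H} (hL : IsSelfAdjointGeOne L) {s : ℝ}
    (h0 : 0 < s) (h1 : s ≤ 1) : L.domain ≤ (rpow L s).domain := by
  intro u hu
  have hB := isBoundedInverse_boundedInverse hL
  have hBu : boundedInverse L (L ⟨u, hu⟩) = u := (hB _ _).1 (L.mem_graph ⟨u, hu⟩)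
  rw [rpow, LinearPMap.inverse_domain]
  rcases h1.lt_or_eq with h1 | rfl
  · refine ⟨⟨(boundedInverse L ^ (1 - s)) (L ⟨u, hu⟩), trivial⟩, ?_⟩
    change (boundedInverse L ^ s) ((boundedInverse L ^ (1 - s)) (L ⟨u, hu⟩)) = u
    rw [← mul_apply_eq_comp, ← boundedInverse_eq_mul hL h0 h1, hBu]
  · refine ⟨⟨L ⟨u, hu⟩, trivial⟩, ?_⟩
    change (boundedInverse L ^ (1 : ℝ)) (L ⟨u, hu⟩) = u
    rw [CFC.rpow_one _ (boundedInverse_nonneg hL), hBu]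

/-- The operator `(K, D(K))` is `(Λ, r)`-cuspidal: `Λ` is self-adjoint with `Λ ≥ 1`, `r ∈ (0, 1]`,
`K` is maximal accretive, `D(Λ)` is contained and dense in `D(K)` endowed with the graph norm, and
for some `C > 0` one has `‖K u‖ ≤ C ‖Λ u‖` and `‖Λ ^ r u‖ ≤ C (‖(K - i t) u‖ + ‖u‖)` for all
`u ∈ D(Λ)` and all real `t`. -/
structure IsCuspidal (L : H →ₗ.[ℂ] H) (r : ℝ) (K : H →ₗ.[ℂ] H) : Prop where
  selfAdjointGeOne : IsSelfAdjointGeOne L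
  exponent_pos : 0 < r
  exponent_le_one : r ≤ 1
  maximalAccretive : IsMaximalAccretive K
  domain_le : L.domain ≤ K.domain
  dense : ∀ x : K.domain, ∀ ε : ℝ, 0 < ε → ∃ u : L.domain,
    ‖(u : H) - x‖ + ‖K ⟨u, domain_le u.2⟩ - K x‖ < ε
  bound : ∃ C : ℝ, 0 < C ∧
    (∀ u : L.domain, ‖K ⟨u, domain_le u.2⟩‖ ≤ C * ‖L u‖) ∧
    (∀ u : L.domain, ∀ t : ℝ,
      ‖rpow L r ⟨u, domain_le_domain_rpow selfAdjointGeOne exponent_pos exponent_le_one u.2⟩‖ ≤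
        C * (‖K ⟨u, domain_le u.2⟩ - (Complex.I * (t : ℂ)) • (u : H)‖ + ‖(u : H)‖))

end Single

section Tensor

variable {H₁ : Type*} [NormedAddCommGroup H₁] [InnerProductSpace ℂ H₁]
variable {H₂ : Type*} [NormedAddCommGroup H₂] [InnerProductSpace ℂ H₂]

variable (H₁ H₂) in
/-- The Hilbert tensor product: the completion of the algebraic tensor product for the inner
product determined by `⟨x₁ ⊗ x₂, y₁ ⊗ y₂⟩ = ⟨x₁, y₁⟩ ⟨x₂, y₂⟩`. -/
abbrev HilbertTensor : Type _ := UniformSpace.Completion (H₁ ⊗[ℂ] H₂)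

variable (H₁ H₂) in
/-- The canonical isometric embedding of the algebraic into the Hilbert tensor product. -/
noncomputable def toHilbertTensor : H₁ ⊗[ℂ] H₂ →ₗᵢ[ℂ] HilbertTensor H₁ H₂ :=
  UniformSpace.Completion.toComplₗᵢ

/-- The inclusion of the algebraic tensor product `D₁ ⊗ D₂` of subspaces into the Hilbert tensor
product. -/
noncomputable def algInclusion (D₁ : Submodule ℂ H₁) (D₂ : Submodule ℂ H₂) :
    D₁ ⊗[ℂ] D₂ →ₗ[ℂ] HilbertTensor H₁ H₂ :=
  (toHilbertTensor H₁ H₂).toLinearMap ∘ₗ TensorProduct.map D₁.subtype D₂.subtype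

theorem algInclusion_injective (D₁ : Submodule ℂ H₁) (D₂ : Submodule ℂ H₂) :
    Function.Injective (algInclusion D₁ D₂) :=
  (toHilbertTensor H₁ H₂).injective.comp
    (TensorProduct.map_injective_of_flat_flat _ _ D₁.subtype_injective D₂.subtype_injective)

/-- The operator `A ⊗ Id + Id ⊗ B` in the Hilbert tensor product, with domain the algebraic tensor
product of `D(A)` and `D(B)`. -/
noncomputable def algTensorSum (A : H₁ →ₗ.[ℂ] H₁) (B : H₂ →ₗ.[ℂ] H₂) :
    HilbertTensor H₁ H₂ →ₗ.[ℂ] HilbertTensor H₁ H₂ where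
  domain := LinearMap.range (algInclusion A.domain B.domain)
  toFun := ((toHilbertTensor H₁ H₂).toLinearMap ∘ₗ
      (TensorProduct.map A.toFun B.domain.subtype + TensorProduct.map A.domain.subtype B.toFun)) ∘ₗ
    (LinearEquiv.ofInjective _ (algInclusion_injective A.domain B.domain)).symm.toLinearMap

theorem algTensorSum_apply_tmul (A : H₁ →ₗ.[ℂ] H₁) (B : H₂ →ₗ.[ℂ] H₂)
    (u : A.domain) (v : B.domain) :
    (toHilbertTensor H₁ H₂ ((u : H₁) ⊗ₜ[ℂ] (v : H₂)),
      toHilbertTensor H₁ H₂ (A u ⊗ₜ[ℂ] (v : H₂) + (u : H₁) ⊗ₜ[ℂ] B v)) ∈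
      (algTensorSum A B).graph := by
  rw [LinearPMap.mem_graph_iff]
  let e := LinearEquiv.ofInjective _ (algInclusion_injective A.domain B.domain)
  refine ⟨e (u ⊗ₜ[ℂ] v), rfl, ?_⟩
  change toHilbertTensor H₁ H₂ ((TensorProduct.map A.toFun B.domain.subtype +
    TensorProduct.map A.domain.subtype B.toFun) (e.symm (e (u ⊗ₜ[ℂ] v)))) = _
  rw [e.symm_apply_apply]
  rfl

/-- The closure of `A ⊗ Id + Id ⊗ B` initially defined on the algebraic tensor product of the
domains. -/
noncomputable def tensorSum (A : H₁ →ₗ.[ℂ] H₁) (B : H₂ →ₗ.[ℂ] H₂) :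
    HilbertTensor H₁ H₂ →ₗ.[ℂ] HilbertTensor H₁ H₂ :=
  (algTensorSum A B).closure

end Tensor

end CuspidalOperator

/-! The heart of the proof is that the subelliptic estimate for K₁, being uniform in the imaginary
shift, survives when the scalar iμ is replaced by an accretive operator on the second factor. With
G₁ = (1/2 + K₁)⁻¹ and S₁ = Λ₁^r₁ G₁ the hypothesis yields ‖S₁ x‖ ≤ C ‖x + iμ G₁ x‖ for all real μ.
Diagonalisation allows i times a Hermitian matrix in place of iμ. For an accretive matrix A + iB (A,
B Hermitian), the function z ↦ (S₁ ⊗ 1)(1 + G₁ ⊗ (zA + iB))⁻¹ x is holomorphic for Re z > 0 and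
bounded by C ‖x‖ on the imaginary axis, so Phragmén–Lindelöf bounds it at z = 1
(`norm_tensorMap_le_of_accretive`). Compression to finite-dimensional subspaces then reaches K₂ - it
(`norm_tensorMap_le_of_re_inner_nonneg`), and Λ₁^r₁ u is controlled by (K + 1/2 - it) u
(`IsCuspidal.exists_norm_tensorMap_rpow_le`).

Exchanging the factors controls Λ₂^r₂ u. Since Λ₁ ⊗ 1 and 1 ⊗ Λ₂ commute, subadditivity of t ↦ t^r
gives ‖Λ^r u‖ ≤ ‖Λ₁^r u‖ + ‖Λ₂^r u‖ (`norm_rpow_apply_le`). This works for every r < min r₁ r₂, a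
larger range than the one claimed, because x² / (8 - 2x) ≤ x on (0, 1].

Unbounded operators enter only through bounded parametrisations of their graphs: by G_j for K_j and
by Λ_j⁻¹ for Λ_j. Maximal accretivity of K and self-adjointness of Λ then rest on the dense range of
G₁ ⊗ 1 + 1 ⊗ G₂ and of Λ₁⁻¹ ⊗ 1 + 1 ⊗ Λ₂⁻¹ (`denseRange_tensorMap_add`). That D(Λ) is a core for K
follows from the dense range of (K_j + 1/2) Λ_j⁻¹. -/

namespace CuspidalOperator

/-! ### Bounded operators on Hilbert tensor products: adjoints, positivity, accretivity -/

section TensorMap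

variable {E F G H E' G' : Type*}
  [NormedAddCommGroup E] [InnerProductSpace ℂ E] [NormedAddCommGroup F] [InnerProductSpace ℂ F]
  [NormedAddCommGroup G] [InnerProductSpace ℂ G] [NormedAddCommGroup H] [InnerProductSpace ℂ H]
  [NormedAddCommGroup E'] [InnerProductSpace ℂ E'] [NormedAddCommGroup G'] [InnerProductSpace ℂ G']

/-- The bounded operator `A ⊗ B` between Hilbert tensor products. -/
noncomputable def tensorMap (A : E →L[ℂ] F) (B : G →L[ℂ] H) :
    HilbertTensor E G →L[ℂ] HilbertTensor F H :=
  (TensorProduct.mapL A B).completion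

theorem tensorMap_apply_coe (A : E →L[ℂ] F) (B : G →L[ℂ] H) (w : E ⊗[ℂ] G) :
    tensorMap A B (toHilbertTensor E G w) =
      toHilbertTensor F H (TensorProduct.mapL A B w) :=
  UniformSpace.Completion.map_coe (TensorProduct.mapL A B).uniformContinuous w

theorem tensorMap_apply_tmul (A : E →L[ℂ] F) (B : G →L[ℂ] H) (x : E) (y : G) :
    tensorMap A B (toHilbertTensor E G (x ⊗ₜ[ℂ] y)) = toHilbertTensor F H (A x ⊗ₜ[ℂ] B y) := by
  rw [tensorMap_apply_coe]; rfl

theorem denseRange_toHilbertTensor : DenseRange (toHilbertTensor E G) :=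
  UniformSpace.Completion.denseRange_coe

/-- Two continuous maps on the Hilbert tensor product coincide when they do on the algebraic
tensor product. -/
theorem tensor_ext_apply {X : Type*} [TopologicalSpace X] [T2Space X]
    {f g : HilbertTensor E G → X} (hf : Continuous f) (hg : Continuous g)
    (h : ∀ w, f (toHilbertTensor E G w) = g (toHilbertTensor E G w)) (x) : f x = g x :=
  congrFun (denseRange_toHilbertTensor.equalizer hf hg (funext h)) x

theorem tensor_ext {X : Type*} [NormedAddCommGroup X] [NormedSpace ℂ X]
    {f g : HilbertTensor E G →L[ℂ] X}
    (h : ∀ x y, f (toHilbertTensor E G (x ⊗ₜ y)) = g (toHilbertTensor E G (x ⊗ₜ y))) : f = g := by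
  ext z
  refine tensor_ext_apply f.continuous g.continuous (fun w => ?_) z
  induction w with
  | zero => simp
  | tmul x y => exact h x y
  | add a b ha hb => simp only [map_add, ha, hb]

theorem tensorMap_comp (A : E →L[ℂ] F) (B : G →L[ℂ] H) (A' : E' →L[ℂ] E) (B' : G' →L[ℂ] G) :
    tensorMap (A ∘L A') (B ∘L B') = tensorMap A B ∘L tensorMap A' B' :=
  tensor_ext fun x y => by simp [tensorMap_apply_tmul]

theorem tensorMap_mul (A A' : E →L[ℂ] E) (B B' : G →L[ℂ] G) :
    tensorMap (A * A') (B * B') = tensorMap A B * tensorMap A' B' :=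
  tensorMap_comp A B A' B'

theorem tensorMap_one : tensorMap (1 : E →L[ℂ] E) (1 : G →L[ℂ] G) = 1 :=
  tensor_ext fun x y => by simp [tensorMap_apply_tmul]

theorem tensorMap_add_left (A A' : E →L[ℂ] F) (B : G →L[ℂ] H) :
    tensorMap (A + A') B = tensorMap A B + tensorMap A' B :=
  tensor_ext fun x y => by simp [tensorMap_apply_tmul, TensorProduct.add_tmul]

theorem tensorMap_add_right (A : E →L[ℂ] F) (B B' : G →L[ℂ] H) :
    tensorMap A (B + B') = tensorMap A B + tensorMap A B' :=
  tensor_ext fun x y => by simp [tensorMap_apply_tmul, TensorProduct.tmul_add]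

theorem tensorMap_sub_left (A A' : E →L[ℂ] F) (B : G →L[ℂ] H) :
    tensorMap (A - A') B = tensorMap A B - tensorMap A' B :=
  tensor_ext fun x y => by simp [tensorMap_apply_tmul, TensorProduct.sub_tmul]

theorem tensorMap_sub_right (A : E →L[ℂ] F) (B B' : G →L[ℂ] H) :
    tensorMap A (B - B') = tensorMap A B - tensorMap A B' :=
  tensor_ext fun x y => by simp [tensorMap_apply_tmul, TensorProduct.tmul_sub]

theorem tensorMap_smul_left (c : ℂ) (A : E →L[ℂ] F) (B : G →L[ℂ] H) :
    tensorMap (c • A) B = c • tensorMap A B :=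
  tensor_ext fun x y => by simp [tensorMap_apply_tmul, ← TensorProduct.smul_tmul']

theorem tensorMap_smul_right (c : ℂ) (A : E →L[ℂ] F) (B : G →L[ℂ] H) :
    tensorMap A (c • B) = c • tensorMap A B :=
  tensor_ext fun x y => by simp [tensorMap_apply_tmul]

theorem norm_tensorMap_le (A : E →L[ℂ] F) (B : G →L[ℂ] H) : ‖tensorMap A B‖ ≤ ‖A‖ * ‖B‖ := by
  refine ContinuousLinearMap.opNorm_le_bound _ (by positivity) fun x => ?_
  induction x using UniformSpace.Completion.induction_on with
  | hp => exact isClosed_le (by fun_prop) (by fun_prop)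
  | ih w =>
    change ‖tensorMap A B (toHilbertTensor E G w)‖ ≤ _ * ‖toHilbertTensor E G w‖
    rw [tensorMap_apply_coe, LinearIsometry.norm_map, LinearIsometry.norm_map]
    exact ((TensorProduct.mapL A B).le_opNorm w).trans
      (mul_le_mul_of_nonneg_right (TensorProduct.norm_mapL_le A B) (norm_nonneg _))

theorem inner_toHilbertTensor_tmul (x x' : E) (y y' : G) :
    ⟪toHilbertTensor E G (x ⊗ₜ y), toHilbertTensor E G (x' ⊗ₜ y')⟫_ℂ =
      ⟪x, x'⟫_ℂ * ⟪y, y'⟫_ℂ := by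
  rw [LinearIsometry.inner_map_map, TensorProduct.inner_tmul]

theorem denseRange_tensorMap {A : E →L[ℂ] F} {B : G →L[ℂ] H} (hA : DenseRange A)
    (hB : DenseRange B) : DenseRange (tensorMap A B) := by
  have key : ∀ w : F ⊗[ℂ] H, toHilbertTensor F H w ∈
      (LinearMap.range (tensorMap A B).toLinearMap).topologicalClosure := by
    intro w
    induction w with
    | zero => simp
    | add a b ha hb => rw [map_add]; exact add_mem ha hb
    | tmul x y =>
      have hc : Continuous fun p : F × H => toHilbertTensor F H (p.1 ⊗ₜ[ℂ] p.2) :=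
        (toHilbertTensor F H).continuous.comp TensorProduct.continuous_tmul
      refine map_mem_closure (s := Set.range A ×ˢ Set.range B) hc (x := (x, y)) ?_ ?_
      · rw [closure_prod_eq]; exact ⟨hA x, hB y⟩
      · rintro ⟨_, _⟩ ⟨⟨a, rfl⟩, ⟨b, rfl⟩⟩
        exact ⟨toHilbertTensor E G (a ⊗ₜ b), tensorMap_apply_tmul A B a b⟩
  intro x
  have hcl : IsClosed ((LinearMap.range (tensorMap A B).toLinearMap).topologicalClosure :
      Set (HilbertTensor F H)) :=
    (LinearMap.range (tensorMap A B).toLinearMap).isClosed_topologicalClosure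
  have := hcl.closure_subset_iff.2 (Set.range_subset_iff.2 key)
  exact this (denseRange_toHilbertTensor x)

theorem re_inner_nonneg_of_nonneg {A : E →L[ℂ] E} (hA : 0 ≤ A) (x : E) : 0 ≤ (⟪x, A x⟫_ℂ).re := by
  rw [ContinuousLinearMap.nonneg_iff_isPositive] at hA
  exact hA.re_inner_nonneg_right x

section Complete

variable [CompleteSpace E] [CompleteSpace F] [CompleteSpace G] [CompleteSpace H]

theorem adjoint_tensorMap (A : E →L[ℂ] F) (B : G →L[ℂ] H) :
    (tensorMap A B).adjoint = tensorMap A.adjoint B.adjoint := by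
  refine ((ContinuousLinearMap.eq_adjoint_iff _ _).2 fun x y => ?_).symm
  refine tensor_ext_apply (f := fun x => ⟪tensorMap A.adjoint B.adjoint x, y⟫_ℂ)
    (g := fun x => ⟪x, tensorMap A B y⟫_ℂ) (by fun_prop) (by fun_prop) (fun w => ?_) x
  refine tensor_ext_apply
    (f := fun y => ⟪tensorMap A.adjoint B.adjoint (toHilbertTensor F H w), y⟫_ℂ)
    (g := fun y => ⟪toHilbertTensor F H w, tensorMap A B y⟫_ℂ)
    (by fun_prop) (by fun_prop) (fun v => ?_) y
  induction w with
  | zero => simp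
  | add a b ha hb => simp only [map_add, inner_add_left, ha, hb]
  | tmul p q =>
    induction v with
    | zero => simp
    | add a b ha hb => simp only [map_add, inner_add_right, ha, hb]
    | tmul s t =>
      simp only [tensorMap_apply_tmul, inner_toHilbertTensor_tmul,
        ContinuousLinearMap.adjoint_inner_left]

theorem denseRange_iff_adjoint_injective {A : E →L[ℂ] F} :
    DenseRange A ↔ Function.Injective A.adjoint := by
  have h1 : DenseRange A ↔ (LinearMap.range A.toLinearMap)ᗮ = ⊥ := by
    rw [← Submodule.topologicalClosure_eq_top_iff, ← Submodule.dense_iff_topologicalClosure_eq_top]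
    rfl
  rw [h1, ContinuousLinearMap.orthogonal_range]
  exact LinearMap.ker_eq_bot

theorem denseRange_adjoint {A : E →L[ℂ] F} (hA : Function.Injective A) : DenseRange A.adjoint := by
  rw [denseRange_iff_adjoint_injective, ContinuousLinearMap.adjoint_adjoint]
  exact hA

/-- By duality: injectivity means dense range of the adjoint, and density of ranges passes to the
completed tensor product, whereas injectivity on the algebraic tensor product would say nothing
about limits. -/
theorem tensorMap_injective {A : E →L[ℂ] F} {B : G →L[ℂ] H} (hA : Function.Injective A)
    (hB : Function.Injective B) : Function.Injective (tensorMap A B) := by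
  have h := denseRange_tensorMap (denseRange_adjoint hA) (denseRange_adjoint hB)
  rwa [denseRange_iff_adjoint_injective, adjoint_tensorMap, ContinuousLinearMap.adjoint_adjoint,
    ContinuousLinearMap.adjoint_adjoint] at h

theorem star_tensorMap (A : E →L[ℂ] E) (B : G →L[ℂ] G) :
    star (tensorMap A B) = tensorMap (star A) (star B) := adjoint_tensorMap A B

/-- With A = S*S and B = T*T the tensor product is (S ⊗ T)*(S ⊗ T). -/
theorem tensorMap_nonneg {A : E →L[ℂ] E} {B : G →L[ℂ] G} (hA : 0 ≤ A) (hB : 0 ≤ B) :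
    0 ≤ tensorMap A B := by
  obtain ⟨S, rfl⟩ := CStarAlgebra.nonneg_iff_eq_star_mul_self.1 hA
  obtain ⟨T, rfl⟩ := CStarAlgebra.nonneg_iff_eq_star_mul_self.1 hB
  rw [tensorMap_mul, ← star_tensorMap]
  exact star_mul_self_nonneg (tensorMap S T)

/-- Turns accretivity, a condition on single vectors, into an operator inequality, which is
preserved by A ↦ A ⊗ 1. -/
theorem re_inner_nonneg_iff {A : E →L[ℂ] E} :
    (∀ x, 0 ≤ (⟪x, A x⟫_ℂ).re) ↔ 0 ≤ A + star A := by
  have h2 : ∀ x, (⟪x, (A + star A) x⟫_ℂ).re = 2 * (⟪x, A x⟫_ℂ).re := fun x => by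
    rw [ContinuousLinearMap.star_eq_adjoint, add_apply, inner_add_right,
      ContinuousLinearMap.adjoint_inner_right, Complex.add_re]
    have := inner_re_symm (𝕜 := ℂ) (A x) x
    simp only [RCLike.re_to_complex] at this
    linarith
  constructor
  · intro h
    rw [ContinuousLinearMap.nonneg_iff_isPositive, ContinuousLinearMap.isPositive_def']
    refine ⟨IsSelfAdjoint.add_star_self A, fun x => ?_⟩
    rw [ContinuousLinearMap.reApplyInnerSelf_apply, inner_re_symm, RCLike.re_to_complex, h2]
    linarith [h x]
  · intro h x
    have := re_inner_nonneg_of_nonneg h x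
    rw [h2] at this
    linarith

theorem re_inner_tensorMap_one_left {X : G →L[ℂ] G} (hX : ∀ x, 0 ≤ (⟪x, X x⟫_ℂ).re)
    (g : HilbertTensor E G) : 0 ≤ (⟪g, tensorMap 1 X g⟫_ℂ).re := by
  revert g
  rw [re_inner_nonneg_iff] at hX ⊢
  rw [star_tensorMap, star_one, ← tensorMap_add_right]
  exact tensorMap_nonneg zero_le_one hX

theorem re_inner_tensorMap_one_right {X : E →L[ℂ] E} (hX : ∀ x, 0 ≤ (⟪x, X x⟫_ℂ).re)
    (g : HilbertTensor E G) : 0 ≤ (⟪g, tensorMap X 1 g⟫_ℂ).re := by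
  revert g
  rw [re_inner_nonneg_iff] at hX ⊢
  rw [star_tensorMap, star_one, ← tensorMap_add_left]
  exact tensorMap_nonneg hX zero_le_one

/-- A lower bound `Re ⟨x, X x⟩ ≥ c ‖X x‖ ^ 2` in the form of the accretivity of a bounded
operator. -/
theorem re_inner_sub_smul_star_mul (X : E →L[ℂ] E) (c : ℝ) (x : E) :
    (⟪x, (X - (c : ℂ) • (star X * X)) x⟫_ℂ).re = (⟪x, X x⟫_ℂ).re - c * ‖X x‖ ^ 2 := by
  have h : ⟪x, (star X * X) x⟫_ℂ = ((‖X x‖ ^ 2 : ℝ) : ℂ) := by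
    rw [ContinuousLinearMap.star_eq_adjoint, mul_apply_eq_comp,
      ContinuousLinearMap.adjoint_inner_right, inner_self_eq_norm_sq_to_K]
    push_cast
    rfl
  rw [sub_apply, smul_apply, inner_sub_right,
    inner_smul_right, h, ← Complex.ofReal_mul, Complex.sub_re, Complex.ofReal_re]

/-- The lower bound says that X - c X*X is accretive, and amplification preserves accretivity. -/
theorem le_re_inner_tensorMap_one_right {X : E →L[ℂ] E} {c : ℝ}
    (hX : ∀ x, c * ‖X x‖ ^ 2 ≤ (⟪x, X x⟫_ℂ).re) (g : HilbertTensor E G) :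
    c * ‖tensorMap X (1 : G →L[ℂ] G) g‖ ^ 2 ≤ (⟪g, tensorMap X 1 g⟫_ℂ).re := by
  have h := re_inner_tensorMap_one_right (G := G) (X := X - (c : ℂ) • (star X * X))
    (fun x => by rw [re_inner_sub_smul_star_mul]; linarith [hX x]) g
  have h2 : tensorMap (star X * X) (1 : G →L[ℂ] G) =
      star (tensorMap X 1) * tensorMap X (1 : G →L[ℂ] G) := by
    rw [star_tensorMap, ← tensorMap_mul, star_one, one_mul]
  rw [tensorMap_sub_left, tensorMap_smul_left, h2, re_inner_sub_smul_star_mul] at h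
  linarith

end Complete

/-- The hypothesis is the accretivity of P*Q, which is amplified and tested on (1 ⊗ R) g. -/
theorem re_inner_tensorMap_left [CompleteSpace E] [CompleteSpace H] {F' : Type*}
    [NormedAddCommGroup F'] [InnerProductSpace ℂ F']
    [CompleteSpace F'] {P Q : E →L[ℂ] F'} (hPQ : ∀ x, 0 ≤ (⟪P x, Q x⟫_ℂ).re) (R : G →L[ℂ] H)
    (g : HilbertTensor E G) : 0 ≤ (⟪tensorMap P R g, tensorMap Q R g⟫_ℂ).re := by
  have h1 : ∀ S : E →L[ℂ] F', tensorMap S R g = tensorMap S 1 (tensorMap 1 R g) := fun S => by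
    rw [← ContinuousLinearMap.comp_apply, ← tensorMap_comp]; rfl
  rw [h1 P, h1 Q, ← ContinuousLinearMap.adjoint_inner_right, adjoint_tensorMap,
    ← ContinuousLinearMap.comp_apply, ← tensorMap_comp]
  have h2 : (ContinuousLinearMap.adjoint (1 : H →L[ℂ] H)).comp (1 : H →L[ℂ] H) = 1 := by
    rw [← ContinuousLinearMap.star_eq_adjoint, star_one]; rfl
  rw [h2]
  refine re_inner_tensorMap_one_right (fun x => ?_) _
  rw [ContinuousLinearMap.comp_apply, ContinuousLinearMap.adjoint_inner_right]
  exact hPQ x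

theorem re_inner_tensorMap_right [CompleteSpace F] [CompleteSpace G] {H' : Type*}
    [NormedAddCommGroup H'] [InnerProductSpace ℂ H']
    [CompleteSpace H'] {P Q : G →L[ℂ] H'} (hPQ : ∀ x, 0 ≤ (⟪P x, Q x⟫_ℂ).re) (R : E →L[ℂ] F)
    (g : HilbertTensor E G) : 0 ≤ (⟪tensorMap R P g, tensorMap R Q g⟫_ℂ).re := by
  have h1 : ∀ S : G →L[ℂ] H', tensorMap R S g = tensorMap 1 S (tensorMap R 1 g) := fun S => by
    rw [← ContinuousLinearMap.comp_apply, ← tensorMap_comp]; rfl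
  rw [h1 P, h1 Q, ← ContinuousLinearMap.adjoint_inner_right, adjoint_tensorMap,
    ← ContinuousLinearMap.comp_apply, ← tensorMap_comp]
  have h2 : (ContinuousLinearMap.adjoint (1 : F →L[ℂ] F)).comp (1 : F →L[ℂ] F) = 1 := by
    rw [← ContinuousLinearMap.star_eq_adjoint, star_one]; rfl
  rw [h2]
  refine re_inner_tensorMap_one_left (fun x => ?_) _
  rw [ContinuousLinearMap.comp_apply, ContinuousLinearMap.adjoint_inner_right]
  exact hPQ x

end TensorMap

/-! ### Closability, surjectivity, self-adjointness and resolvents of unbounded operators -/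

section Unbounded

variable {H : Type*} [NormedAddCommGroup H] [InnerProductSpace ℂ H]

/-- A densely defined accretive operator is closable. -/
theorem isClosable_of_accretive {K : H →ₗ.[ℂ] H} (hd : Dense (K.domain : Set H))
    (ha : ∀ p ∈ K.graph, 0 ≤ (⟪p.1, p.2⟫_ℂ).re) : K.IsClosable := by
  have hcl : ∀ p ∈ K.graph.topologicalClosure, 0 ≤ (⟪p.1, p.2⟫_ℂ).re := by
    have hc : IsClosed {p : H × H | 0 ≤ (⟪p.1, p.2⟫_ℂ).re} :=
      isClosed_le continuous_const (by fun_prop)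
    exact fun p hp => closure_minimal (s := (K.graph : Set (H × H))) ha hc hp
  have h0 : ∀ p ∈ K.graph.topologicalClosure, p.1 = 0 → p.2 = 0 := by
    rintro ⟨x, y⟩ hp (rfl : x = 0)
    have hortho : ∀ a ∈ K.domain, ⟪a, y⟫_ℂ = 0 := by
      intro a ha'
      have hab : (a, K ⟨a, ha'⟩) ∈ K.graph.topologicalClosure :=
        K.graph.le_topologicalClosure (K.mem_graph ⟨a, ha'⟩)
      -- The closed graph is a subspace, so z • (0, y) may be added to (a, K a). If ⟨a, y⟩ were
      -- nonzero, a suitable z would make the resulting real part -1.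
      have key : ∀ z : ℂ, 0 ≤ (⟪a, K ⟨a, ha'⟩⟫_ℂ).re + (z * ⟪a, y⟫_ℂ).re := fun z => by
        have := hcl _ (add_mem hab (K.graph.topologicalClosure.smul_mem z hp))
        simpa [inner_add_right, inner_smul_right] using this
      set α := (⟪a, K ⟨a, ha'⟩⟫_ℂ).re
      set β := ⟪a, y⟫_ℂ
      by_contra hβ
      have h := key (-((α + 1 : ℝ) : ℂ) * β⁻¹)
      rw [mul_assoc, inv_mul_cancel₀ hβ, mul_one, Complex.neg_re, Complex.ofReal_re] at h
      linarith
    exact hd.eq_zero_of_inner_right ℂ fun v hv => hortho v hv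
  exact ⟨_, (Submodule.toLinearPMap_graph_eq _ h0).symm⟩

/-- A closed operator `T` such that `σ + T` is bounded below and has dense range is such that
`σ + T` is surjective. -/
theorem surjective_of_isClosed [CompleteSpace H] {K : H →ₗ.[ℂ] H} (hcl : K.IsClosed) (σ : ℂ)
    (hb : ∀ u : K.domain, ‖(u : H)‖ ≤ ‖σ • (u : H) + K u‖)
    (hd : DenseRange fun u : K.domain => σ • (u : H) + K u) :
    Function.Surjective fun u : K.domain => σ • (u : H) + K u := by
  intro z
  obtain ⟨y, hy, hyz⟩ := mem_closure_iff_seq_limit.1 (hd z)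
  choose u hu using hy
  have hc : CauchySeq fun n => (u n : H) := by
    have hyc := hyz.cauchySeq
    rw [Metric.cauchySeq_iff] at hyc ⊢
    intro ε hε
    obtain ⟨N, hN⟩ := hyc ε hε
    refine ⟨N, fun m hm n hn => lt_of_le_of_lt ?_ (hN m hm n hn)⟩
    rw [dist_eq_norm, dist_eq_norm, ← hu m, ← hu n]
    refine (hb (u m - u n)).trans_eq ?_
    rw [LinearPMap.map_sub, AddSubgroupClass.coe_sub, smul_sub,
      sub_add_sub_comm]
  obtain ⟨x, hx⟩ := cauchySeq_tendsto_of_complete hc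
  have hmem : (x, z - σ • x) ∈ K.graph := by
    refine hcl.mem_of_tendsto (hx.prodMk_nhds (hyz.sub (hx.const_smul σ)))
      (Filter.Eventually.of_forall fun n => ?_)
    have : y n - σ • (u n : H) = K (u n) := by rw [← hu n]; simp
    change ((u n : H), y n - σ • (u n : H)) ∈ (K.graph : Set (H × H))
    rw [this]
    exact K.mem_graph (u n)
  obtain ⟨w, hw, hw'⟩ := K.mem_graph_iff.1 hmem
  refine ⟨w, ?_⟩
  simp only at hw hw' ⊢
  rw [hw, hw']
  simp

/-- A densely defined symmetric surjective operator is self-adjoint. -/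
theorem isSelfAdjoint_of_surjective [CompleteSpace H] {L : H →ₗ.[ℂ] H}
    (hd : Dense (L.domain : Set H)) (hs : ∀ u v : L.domain, ⟪L u, (v : H)⟫_ℂ = ⟪(u : H), L v⟫_ℂ)
    (hsurj : Function.Surjective L) : IsSelfAdjoint L := by
  have hle : L ≤ L.adjoint := LinearPMap.IsFormalAdjoint.le_adjoint hd hs
  rw [LinearPMap.isSelfAdjoint_def]
  refine (LinearPMap.eq_of_le_of_domain_eq hle (le_antisymm hle.1 fun v hv => ?_)).symm
  -- The vector u in D(L) has the same image as v under the adjoint, so v - u is orthogonal to the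
  -- range of L, which is the whole space.
  obtain ⟨u, hu⟩ := hsurj (L.adjoint ⟨v, hv⟩)
  have hadj := LinearPMap.adjoint_isFormalAdjoint hd
  have : v - u = 0 := by
    rw [← inner_self_eq_zero (𝕜 := ℂ)]
    obtain ⟨w, hw⟩ := hsurj (v - u)
    have h1 := hadj ⟨v, hv⟩ w
    rw [← hu, hs, hw] at h1
    rw [inner_sub_left, h1, sub_self]
  rw [sub_eq_zero.1 this]
  exact u.2

theorem IsMaximalAccretive.re_nonneg_of_mem_graph {K : H →ₗ.[ℂ] H} (hK : IsMaximalAccretive K)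
    {p : H × H} (hp : p ∈ K.graph) : 0 ≤ (⟪p.1, p.2⟫_ℂ).re := by
  obtain ⟨u, hu, hu'⟩ := K.mem_graph_iff.1 hp
  rw [← hu, ← hu']
  exact hK.accretive u

theorem norm_le_norm_add_of_re_inner_nonneg {x y : H} (h : 0 ≤ (⟪x, y⟫_ℂ).re) : ‖x‖ ≤ ‖x + y‖ := by
  have h1 : ‖x + y‖ ^ 2 = ‖x‖ ^ 2 + 2 * (⟪x, y⟫_ℂ).re + ‖y‖ ^ 2 :=
    norm_add_sq (𝕜 := ℂ) x y
  nlinarith [norm_nonneg x, norm_nonneg y, norm_nonneg (x + y), sq_nonneg ‖y‖,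
    abs_le_of_sq_le_sq' (show ‖x‖ ^ 2 ≤ ‖x + y‖ ^ 2 by nlinarith [sq_nonneg ‖y‖]) (norm_nonneg _)]

/-- The resolvent `G = (1/2 + K)⁻¹` of a maximal accretive operator `K`. -/
theorem IsMaximalAccretive.exists_resolvent [CompleteSpace H] {K : H →ₗ.[ℂ] H}
    (hK : IsMaximalAccretive K) :
    ∃ G : H →L[ℂ] H, (∀ p : H × H, p ∈ K.graph ↔ ∃ g, (G g, g - (1 / 2 : ℂ) • G g) = p) ∧
      (∀ g, 1 / 2 * ‖G g‖ ^ 2 ≤ (⟪g, G g⟫_ℂ).re) ∧ Function.Injective G ∧ DenseRange G := by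
  let f : K.domain →ₗ[ℂ] H := K.domain.subtype + K.toFun
  let e : K.domain ≃ₗ[ℂ] H := LinearEquiv.ofBijective f hK.bijective
  have he : ∀ u, e u = (u : H) + K u := fun _ => rfl
  let R : H →L[ℂ] H := (K.domain.subtype ∘ₗ e.symm.toLinearMap).mkContinuous 1 fun y => by
    have := norm_le_norm_add_of_re_inner_nonneg (hK.accretive (e.symm y))
    rw [← he, e.apply_symm_apply] at this
    simpa using this
  have hRn : ‖R‖ ≤ 1 := LinearMap.mkContinuous_norm_le _ zero_le_one _
  have hRe : ∀ y, R y = (e.symm y : H) := fun _ => rfl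
  have hgr : ∀ x y : H, (x, y) ∈ K.graph ↔ R (x + y) = x := by
    intro x y
    rw [LinearPMap.mem_graph_iff]
    constructor
    · rintro ⟨u, rfl, rfl⟩
      rw [← he, hRe, e.symm_apply_apply]
    · intro h
      refine ⟨e.symm (x + y), h, ?_⟩
      have := he (e.symm (x + y))
      rw [e.apply_symm_apply, ← hRe, h] at this
      exact (add_left_cancel this).symm
  -- With R = (1 + K)⁻¹ one has 1/2 + K = (1 - R/2)(1 + K), hence G = R (1 - R/2)⁻¹; the Neumann
  -- series converges as ‖R‖ ≤ 1.
  have hY : IsUnit (1 - (1 / 2 : ℂ) • R) := by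
    refine isUnit_one_sub_of_norm_lt_one ?_
    rw [norm_smul]
    norm_num
    linarith
  obtain ⟨Y, hY⟩ := hY
  have hYY : ∀ g, Y.1 ((Y⁻¹).1 g) = g := fun g => by
    rw [← mul_apply_eq_comp, Units.mul_inv]; rfl
  have hYY' : ∀ g, (Y⁻¹).1 (Y.1 g) = g := fun g => by
    rw [← mul_apply_eq_comp, Units.inv_mul]; rfl
  have hYa : ∀ g, Y.1 g = g - (1 / 2 : ℂ) • R g := fun g => by rw [hY]; simp
  have main : ∀ p : H × H, p ∈ K.graph ↔
      ∃ g, ((R * (Y⁻¹).1) g, g - (1 / 2 : ℂ) • (R * (Y⁻¹).1) g) = p := by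
    rintro ⟨x, y⟩
    rw [hgr]
    constructor
    · intro h
      refine ⟨Y.1 (x + y), ?_⟩
      rw [mul_apply_eq_comp, hYY', hYa, h, sub_sub, ← add_smul]
      norm_num
    · rintro ⟨g, hg⟩
      obtain ⟨rfl, rfl⟩ := Prod.ext_iff.1 hg
      have h2 := hYa ((Y⁻¹).1 g)
      rw [hYY] at h2
      simp only [mul_apply_eq_comp]
      set k := (Y⁻¹).1 g
      congr 1
      rw [h2, sub_sub, ← add_smul]
      norm_num
  have hmem : ∀ g, ((R * (Y⁻¹).1) g, g - (1 / 2 : ℂ) • (R * (Y⁻¹).1) g) ∈ K.graph :=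
    fun g => (main _).2 ⟨g, rfl⟩
  refine ⟨R * (Y⁻¹).1, main, fun g => ?_, ?_, ?_⟩
  -- The lower bound is Re ⟨G g, K G g⟩ ≥ 0 rewritten with K G g = g - G g / 2.
  · have h := hK.re_nonneg_of_mem_graph (hmem g)
    simp only at h
    generalize (R * (Y⁻¹).1) g = x at h ⊢
    have h1 := inner_re_symm (𝕜 := ℂ) g x
    have h2 := inner_self_eq_norm_sq (𝕜 := ℂ) x
    simp only [RCLike.re_to_complex] at h1 h2
    rw [inner_sub_right, inner_smul_right, Complex.sub_re, show (1 / 2 : ℂ) = ((1 / 2 : ℝ) : ℂ) by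
      norm_num, Complex.re_ofReal_mul, h2] at h
    linarith
  · rw [injective_iff_map_eq_zero]
    intro g hg
    have h := hmem g
    rw [hg, smul_zero, sub_zero] at h
    obtain ⟨u, hu, hu'⟩ := K.mem_graph_iff.1 h
    have : u = 0 := Subtype.ext hu
    rw [this, LinearPMap.map_zero] at hu'
    exact hu'.symm
  · refine hK.dense_domain.mono fun x hx => ?_
    obtain ⟨g, hg⟩ := (main _).1 (K.mem_graph ⟨x, hx⟩)
    exact ⟨g, congrArg Prod.fst hg⟩

end Unbounded

/-! ### Parametrising the graph of an algebraic tensor sum -/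

section TensorSum

variable {H₁ : Type*} [NormedAddCommGroup H₁] [InnerProductSpace ℂ H₁]
variable {H₂ : Type*} [NormedAddCommGroup H₂] [InnerProductSpace ℂ H₂]

/-- Think of A as Q₁ P₁⁻¹ and of B as Q₂ P₂⁻¹. Together with the converse below, this moves
questions about the domain of the tensor sum to bounded operators. -/
theorem mem_graph_algTensorSum {A : H₁ →ₗ.[ℂ] H₁} {B : H₂ →ₗ.[ℂ] H₂} {P₁ Q₁ : H₁ →L[ℂ] H₁}
    {P₂ Q₂ : H₂ →L[ℂ] H₂} (h₁ : ∀ x, (P₁ x, Q₁ x) ∈ A.graph) (h₂ : ∀ x, (P₂ x, Q₂ x) ∈ B.graph)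
    (w : H₁ ⊗[ℂ] H₂) :
    (tensorMap P₁ P₂ (toHilbertTensor H₁ H₂ w),
      (tensorMap Q₁ P₂ + tensorMap P₁ Q₂) (toHilbertTensor H₁ H₂ w)) ∈
      (algTensorSum A B).graph := by
  induction w with
  | zero => simp only [map_zero]; exact zero_mem _
  | add a b ha hb =>
    have := add_mem ha hb
    rw [Prod.mk_add_mk] at this
    simpa only [map_add] using this
  | tmul x y =>
    obtain ⟨u, hu, hu'⟩ := A.mem_graph_iff.1 (h₁ x)
    obtain ⟨v, hv, hv'⟩ := B.mem_graph_iff.1 (h₂ y)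
    have := algTensorSum_apply_tmul A B u v
    simp only at hu hu' hv hv'
    rw [hu, hu', hv, hv'] at this
    rw [add_apply, tensorMap_apply_tmul, tensorMap_apply_tmul, tensorMap_apply_tmul, ← map_add]
    exact this

theorem exists_of_mem_graph_algTensorSum {A : H₁ →ₗ.[ℂ] H₁} {B : H₂ →ₗ.[ℂ] H₂}
    {P₁ Q₁ : H₁ →L[ℂ] H₁} {P₂ Q₂ : H₂ →L[ℂ] H₂} (h₁ : ∀ p ∈ A.graph, ∃ x, (P₁ x, Q₁ x) = p)
    (h₂ : ∀ p ∈ B.graph, ∃ x, (P₂ x, Q₂ x) = p) {p : HilbertTensor H₁ H₂ × HilbertTensor H₁ H₂}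
    (hp : p ∈ (algTensorSum A B).graph) :
    ∃ w : H₁ ⊗[ℂ] H₂, (tensorMap P₁ P₂ (toHilbertTensor H₁ H₂ w),
      (tensorMap Q₁ P₂ + tensorMap P₁ Q₂) (toHilbertTensor H₁ H₂ w)) = p := by
  obtain ⟨u, hu, hu'⟩ := LinearPMap.mem_graph_iff _ |>.1 hp
  let e := LinearEquiv.ofInjective _ (algInclusion_injective A.domain B.domain)
  obtain ⟨z, rfl⟩ := e.surjective u
  have key : ∀ z : A.domain ⊗[ℂ] B.domain, ∃ w : H₁ ⊗[ℂ] H₂,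
      tensorMap P₁ P₂ (toHilbertTensor H₁ H₂ w) = algInclusion A.domain B.domain z ∧
      (tensorMap Q₁ P₂ + tensorMap P₁ Q₂) (toHilbertTensor H₁ H₂ w) =
        toHilbertTensor H₁ H₂ ((TensorProduct.map A.toFun B.domain.subtype +
          TensorProduct.map A.domain.subtype B.toFun) z) := by
    intro z
    induction z with
    | zero => exact ⟨0, by simp, by simp⟩
    | add a b ha hb =>
      obtain ⟨w, hw, hw'⟩ := ha
      obtain ⟨v, hv, hv'⟩ := hb
      refine ⟨w + v, ?_, ?_⟩
      · simp only [map_add, hw, hv]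
      · rw [map_add, map_add, map_add, map_add, hw', hv']
    | tmul x y =>
      obtain ⟨a, ha⟩ := h₁ _ (A.mem_graph x)
      obtain ⟨b, hb⟩ := h₂ _ (B.mem_graph y)
      obtain ⟨ha, ha'⟩ := Prod.ext_iff.1 ha
      obtain ⟨hb, hb'⟩ := Prod.ext_iff.1 hb
      simp only at ha ha' hb hb'
      refine ⟨a ⊗ₜ b, ?_, ?_⟩
      · rw [tensorMap_apply_tmul, ha, hb]; rfl
      · rw [add_apply, tensorMap_apply_tmul, tensorMap_apply_tmul, ha, hb, ha', hb', ← map_add]; rfl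
  obtain ⟨w, hw, hw'⟩ := key z
  refine ⟨w, Prod.ext (hw.trans hu) (hw'.trans ?_)⟩
  rw [← hu']
  change _ = toHilbertTensor H₁ H₂ ((TensorProduct.map A.toFun B.domain.subtype +
    TensorProduct.map A.domain.subtype B.toFun) (e.symm (e z)))
  rw [e.symm_apply_apply]

end TensorSum

/-! ### The closed tensor sum: maximal accretivity and self-adjointness -/

section TensorSum

variable {H₁ : Type*} [NormedAddCommGroup H₁] [InnerProductSpace ℂ H₁]
variable {H₂ : Type*} [NormedAddCommGroup H₂] [InnerProductSpace ℂ H₂]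

theorem le_re_inner_of_le {H : Type*} [NormedAddCommGroup H] [InnerProductSpace ℂ H] (c : ℝ)
    (x y : H) : (⟪x, y - (c : ℂ) • x⟫_ℂ).re = (⟪x, y⟫_ℂ).re - c * ‖x‖ ^ 2 := by
  have h2 := inner_self_eq_norm_sq (𝕜 := ℂ) x
  simp only [RCLike.re_to_complex] at h2
  rw [inner_sub_right, inner_smul_right, Complex.sub_re, Complex.re_ofReal_mul, h2]

theorem closure_graph_induction {A : H₁ →ₗ.[ℂ] H₁} (hA : A.IsClosable) {S : Set (H₁ × H₁)}
    (hS : IsClosed S) (h : ∀ p ∈ A.graph, p ∈ S) {p : H₁ × H₁} (hp : p ∈ A.closure.graph) :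
    p ∈ S := by
  rw [← hA.graph_closure_eq_closure_graph] at hp
  exact closure_minimal (s := (A.graph : Set (H₁ × H₁))) h hS hp

theorem le_re_inner_of_mem_graph_closure {A : H₁ →ₗ.[ℂ] H₁} (hA : A.IsClosable) {c : ℝ}
    (h : ∀ p ∈ A.graph, c * ‖p.1‖ ^ 2 ≤ (⟪p.1, p.2⟫_ℂ).re) {p : H₁ × H₁}
    (hp : p ∈ A.closure.graph) : c * ‖p.1‖ ^ 2 ≤ (⟪p.1, p.2⟫_ℂ).re :=
  closure_graph_induction hA (S := {p | c * ‖p.1‖ ^ 2 ≤ (⟪p.1, p.2⟫_ℂ).re})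
    (isClosed_le (by fun_prop) (by fun_prop)) h hp

theorem mem_graph_closure {A : H₁ →ₗ.[ℂ] H₁} {p : H₁ × H₁} (hp : p ∈ A.graph) :
    p ∈ A.closure.graph :=
  LinearPMap.le_graph_of_le A.le_closure hp

/-- If the bounded operators `P₁`, `P₂` have dense range, the algebraic tensor product of the
domains is dense. -/
theorem dense_domain_algTensorSum {A : H₁ →ₗ.[ℂ] H₁} {B : H₂ →ₗ.[ℂ] H₂} {P₁ Q₁ : H₁ →L[ℂ] H₁}
    {P₂ Q₂ : H₂ →L[ℂ] H₂} (h₁ : ∀ x, (P₁ x, Q₁ x) ∈ A.graph) (h₂ : ∀ x, (P₂ x, Q₂ x) ∈ B.graph)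
    (hd₁ : DenseRange P₁) (hd₂ : DenseRange P₂) :
    Dense ((algTensorSum A B).domain : Set (HilbertTensor H₁ H₂)) := by
  refine ((denseRange_tensorMap hd₁ hd₂).comp denseRange_toHilbertTensor
    (tensorMap P₁ P₂).continuous).mono ?_
  rintro _ ⟨w, rfl⟩
  exact LinearPMap.mem_domain_of_mem_graph (mem_graph_algTensorSum h₁ h₂ w)

theorem inner_symm_of_mem_graph_closure {L : H₁ →ₗ.[ℂ] H₁} (hL : L.IsClosable)
    (h : ∀ p ∈ L.graph, ∀ q ∈ L.graph, ⟪p.2, q.1⟫_ℂ = ⟪p.1, q.2⟫_ℂ) {p q : H₁ × H₁}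
    (hp : p ∈ L.closure.graph) (hq : q ∈ L.closure.graph) : ⟪p.2, q.1⟫_ℂ = ⟪p.1, q.2⟫_ℂ := by
  have h1 : ∀ p ∈ L.graph, ⟪p.2, q.1⟫_ℂ = ⟪p.1, q.2⟫_ℂ := fun p hp =>
    closure_graph_induction hL (S := {q | ⟪p.2, q.1⟫_ℂ = ⟪p.1, q.2⟫_ℂ})
      (isClosed_eq (by fun_prop) (by fun_prop)) (h p hp) hq
  exact closure_graph_induction hL (S := {p | ⟪p.2, q.1⟫_ℂ = ⟪p.1, q.2⟫_ℂ})
    (isClosed_eq (by fun_prop) (by fun_prop)) h1 hp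

variable [CompleteSpace H₁] [CompleteSpace H₂]

/-- This is the symmetry of the possibly unbounded operator b P⁻¹, tested on the graph points (P x,
b x). -/
theorem inner_apply_comm_of_star_eq {P b : H₁ →L[ℂ] H₁} (hP : star P = P) (hb : star b = b)
    (h : P * b = b * P) (x y : H₁) : ⟪b x, P y⟫_ℂ = ⟪P x, b y⟫_ℂ := by
  calc ⟪b x, P y⟫_ℂ = ⟪x, (b * P) y⟫_ℂ := by
        rw [mul_apply_eq_comp, ← ContinuousLinearMap.adjoint_inner_right b,
          ← ContinuousLinearMap.star_eq_adjoint, hb]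
    _ = ⟪P x, b y⟫_ℂ := by
        rw [← h, mul_apply_eq_comp, ← ContinuousLinearMap.adjoint_inner_right P,
          ← ContinuousLinearMap.star_eq_adjoint, hP]

/-- Accretivity of `A ⊗ 1 + 1 ⊗ B` on the algebraic tensor product of the domains, in terms of
bounded parametrizations of the graphs of `A` and `B`. -/
theorem le_re_inner_of_mem_graph_algTensorSum {A : H₁ →ₗ.[ℂ] H₁} {B : H₂ →ₗ.[ℂ] H₂}
    {P₁ Q₁ : H₁ →L[ℂ] H₁} {P₂ Q₂ : H₂ →L[ℂ] H₂} (h₁ : ∀ p ∈ A.graph, ∃ x, (P₁ x, Q₁ x) = p)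
    (h₂ : ∀ p ∈ B.graph, ∃ x, (P₂ x, Q₂ x) = p) {c : ℝ}
    (ha₁ : ∀ x, c * ‖P₁ x‖ ^ 2 ≤ (⟪P₁ x, Q₁ x⟫_ℂ).re) (ha₂ : ∀ x, 0 ≤ (⟪P₂ x, Q₂ x⟫_ℂ).re)
    {p : HilbertTensor H₁ H₂ × HilbertTensor H₁ H₂} (hp : p ∈ (algTensorSum A B).graph) :
    c * ‖p.1‖ ^ 2 ≤ (⟪p.1, p.2⟫_ℂ).re := by
  obtain ⟨w, rfl⟩ := exists_of_mem_graph_algTensorSum h₁ h₂ hp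
  have e1 := re_inner_tensorMap_left (P := P₁) (Q := Q₁ - (c : ℂ) • P₁) (fun x => by
    rw [sub_apply, smul_apply, le_re_inner_of_le]; linarith [ha₁ x]) P₂ (toHilbertTensor H₁ H₂ w)
  have e2 := re_inner_tensorMap_right ha₂ P₁ (toHilbertTensor H₁ H₂ w)
  rw [tensorMap_sub_left, tensorMap_smul_left, sub_apply, smul_apply, le_re_inner_of_le] at e1
  simp only [add_apply, inner_add_right, Complex.add_re]
  linarith

theorem IsBoundedInverse.mem_graph_iff {H : Type*} [NormedAddCommGroup H] [InnerProductSpace ℂ H]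
    {L : H →ₗ.[ℂ] H} {A : H →L[ℂ] H} (h : IsBoundedInverse L A) (p : H × H) :
    p ∈ L.graph ↔ ∃ x, (A x, (1 : H →L[ℂ] H) x) = p := by
  obtain ⟨x, y⟩ := p
  rw [h]
  constructor
  · rintro rfl
    exact ⟨y, rfl⟩
  · rintro ⟨z, hz⟩
    obtain ⟨rfl, rfl⟩ := Prod.ext_iff.1 hz
    rfl

/-- If `Re ⟨x, G x⟩ ≥ c ‖G x‖ ^ 2` with `c > 0` and `G` injective, then `G ⊗ 1 + 1 ⊗ G'` has dense
range for any accretive `G'`. -/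
theorem denseRange_tensorMap_add {G₁ : H₁ →L[ℂ] H₁} {G₂ : H₂ →L[ℂ] H₂} {c : ℝ} (hc : 0 < c)
    (h₁ : ∀ x, c * ‖G₁ x‖ ^ 2 ≤ (⟪x, G₁ x⟫_ℂ).re) (hi : Function.Injective G₁)
    (h₂ : ∀ x, 0 ≤ (⟪x, G₂ x⟫_ℂ).re) :
    DenseRange (tensorMap G₁ (1 : H₂ →L[ℂ] H₂) + tensorMap (1 : H₁ →L[ℂ] H₁) G₂) := by
  rw [denseRange_iff_adjoint_injective, injective_iff_map_eq_zero]
  intro g hg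
  -- The real part of this pairing is at least c ‖(G₁ ⊗ 1) g‖², so a vector killed by the adjoint is
  -- killed by the injective G₁ ⊗ 1.
  have h3 : ⟪(tensorMap G₁ 1 + tensorMap 1 G₂).adjoint g, g⟫_ℂ = 0 := by rw [hg, inner_zero_left]
  rw [ContinuousLinearMap.adjoint_inner_left, add_apply, inner_add_right] at h3
  have h4 := le_re_inner_tensorMap_one_right h₁ g
  have h5 := re_inner_tensorMap_one_left h₂ g
  have h6 := congrArg Complex.re h3
  rw [Complex.add_re, Complex.zero_re] at h6
  have h7 : ‖tensorMap G₁ (1 : H₂ →L[ℂ] H₂) g‖ ^ 2 ≤ 0 := by nlinarith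
  have h8 : tensorMap G₁ (1 : H₂ →L[ℂ] H₂) g = 0 := by
    rw [← norm_eq_zero]; exact pow_eq_zero_iff two_ne_zero |>.1 (le_antisymm h7 (sq_nonneg _))
  exact (map_eq_zero_iff _ (tensorMap_injective hi (fun _ _ h => h))).1 h8

theorem isClosable_algTensorSum {K₁ : H₁ →ₗ.[ℂ] H₁} {K₂ : H₂ →ₗ.[ℂ] H₂}
    (h₁ : IsMaximalAccretive K₁) (h₂ : IsMaximalAccretive K₂) :
    (algTensorSum K₁ K₂).IsClosable := by
  obtain ⟨G₁, hG₁, ha₁, -, hd₁⟩ := h₁.exists_resolvent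
  obtain ⟨G₂, hG₂, ha₂, -, hd₂⟩ := h₂.exists_resolvent
  have m₁ : ∀ x, (G₁ x, ((1 : H₁ →L[ℂ] H₁) - (1 / 2 : ℂ) • G₁) x) ∈ K₁.graph :=
    fun x => (hG₁ _).2 ⟨x, rfl⟩
  have m₂ : ∀ x, (G₂ x, ((1 : H₂ →L[ℂ] H₂) - (1 / 2 : ℂ) • G₂) x) ∈ K₂.graph :=
    fun x => (hG₂ _).2 ⟨x, rfl⟩
  refine isClosable_of_accretive (dense_domain_algTensorSum m₁ m₂ hd₁ hd₂) fun p hp => ?_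
  have := le_re_inner_of_mem_graph_algTensorSum (c := 0) (P₁ := G₁)
    (Q₁ := (1 : H₁ →L[ℂ] H₁) - (1 / 2 : ℂ) • G₁) (P₂ := G₂)
    (Q₂ := (1 : H₂ →L[ℂ] H₂) - (1 / 2 : ℂ) • G₂) (fun p hp => (hG₁ p).1 hp)
    (fun p hp => (hG₂ p).1 hp)
    (fun x => by rw [zero_mul]; exact h₁.re_nonneg_of_mem_graph (m₁ x))
    (fun x => h₂.re_nonneg_of_mem_graph (m₂ x)) hp
  rwa [zero_mul] at this

theorem isMaximalAccretive_tensorSum {K₁ : H₁ →ₗ.[ℂ] H₁} {K₂ : H₂ →ₗ.[ℂ] H₂}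
    (h₁ : IsMaximalAccretive K₁) (h₂ : IsMaximalAccretive K₂) :
    IsMaximalAccretive (tensorSum K₁ K₂) := by
  have hcl := isClosable_algTensorSum h₁ h₂
  obtain ⟨G₁, hG₁, ha₁, hi₁, hd₁⟩ := h₁.exists_resolvent
  obtain ⟨G₂, hG₂, ha₂, hi₂, hd₂⟩ := h₂.exists_resolvent
  have m₁ : ∀ x, (G₁ x, ((1 : H₁ →L[ℂ] H₁) - (1 / 2 : ℂ) • G₁) x) ∈ K₁.graph :=
    fun x => (hG₁ _).2 ⟨x, rfl⟩
  have m₂ : ∀ x, (G₂ x, ((1 : H₂ →L[ℂ] H₂) - (1 / 2 : ℂ) • G₂) x) ∈ K₂.graph :=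
    fun x => (hG₂ _).2 ⟨x, rfl⟩
  have hdom := dense_domain_algTensorSum m₁ m₂ hd₁ hd₂
  have hacc : ∀ p ∈ (tensorSum K₁ K₂).graph, 0 ≤ (⟪p.1, p.2⟫_ℂ).re := by
    intro p hp
    have := le_re_inner_of_mem_graph_closure (c := 0) hcl (fun p hp =>
      le_re_inner_of_mem_graph_algTensorSum (c := 0) (P₁ := G₁)
        (Q₁ := (1 : H₁ →L[ℂ] H₁) - (1 / 2 : ℂ) • G₁) (P₂ := G₂)
        (Q₂ := (1 : H₂ →L[ℂ] H₂) - (1 / 2 : ℂ) • G₂) (fun p hp => (hG₁ p).1 hp)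
        (fun p hp => (hG₂ p).1 hp)
        (fun x => by rw [zero_mul]; exact h₁.re_nonneg_of_mem_graph (m₁ x))
        (fun x => h₂.re_nonneg_of_mem_graph (m₂ x)) hp) hp
    rwa [zero_mul] at this
  have hb : ∀ u : (tensorSum K₁ K₂).domain,
      ‖(u : HilbertTensor H₁ H₂)‖ ≤ ‖(u : HilbertTensor H₁ H₂) + tensorSum K₁ K₂ u‖ :=
    fun u => norm_le_norm_add_of_re_inner_nonneg (hacc _ (LinearPMap.mem_graph _ u))
  refine ⟨hdom.mono (algTensorSum K₁ K₂).le_closure.1,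
    fun u => hacc _ (LinearPMap.mem_graph _ u), ?_, ?_⟩
  · intro u v huv
    have h := hb (u - v)
    have h3 : ((u - v : (tensorSum K₁ K₂).domain) : HilbertTensor H₁ H₂) +
        tensorSum K₁ K₂ (u - v) = 0 := by
      rw [LinearPMap.map_sub, AddSubgroupClass.coe_sub, sub_add_sub_comm]
      exact sub_eq_zero.2 huv
    rw [h3, norm_zero, norm_le_zero_iff] at h
    exact Subtype.ext (sub_eq_zero.1 h)
  · have hs := surjective_of_isClosed (K := tensorSum K₁ K₂) hcl.closure_isClosed 1
      (fun u => by rw [one_smul]; exact hb u) ?_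
    · simpa only [one_smul] using hs
    -- The two shifts by 1/2 add up to 1, so (1 + K)(G₁ ⊗ G₂) = 1 ⊗ G₂ + G₁ ⊗ 1; this is why the
    -- resolvents are taken at 1/2.
    · have hD := denseRange_tensorMap_add (by norm_num) ha₁ hi₁
        (fun x => (by positivity : (0 : ℝ) ≤ _).trans (ha₂ x))
      refine (hD.comp denseRange_toHilbertTensor
        (ContinuousLinearMap.continuous _)).mono ?_
      rintro _ ⟨w, rfl⟩
      obtain ⟨u, hu, hu'⟩ := LinearPMap.mem_graph_iff _ |>.1
        (mem_graph_closure (mem_graph_algTensorSum m₁ m₂ w))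
      refine ⟨u, ?_⟩
      change (1 : ℂ) • (u : HilbertTensor H₁ H₂) + (algTensorSum K₁ K₂).closure u = _
      rw [hu, hu', one_smul]
      simp only [tensorMap_sub_left, tensorMap_sub_right, tensorMap_smul_left,
        tensorMap_smul_right, add_apply, sub_apply, smul_apply, Function.comp_apply]
      module

theorem le_re_inner_boundedInverse {L₁ : H₁ →ₗ.[ℂ] H₁} (h₁ : IsSelfAdjointGeOne L₁) (x : H₁) :
    1 * ‖boundedInverse L₁ x‖ ^ 2 ≤ (⟪boundedInverse L₁ x, x⟫_ℂ).re := by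
  obtain ⟨u, hu, hu'⟩ := L₁.mem_graph_iff.1 ((isBoundedInverse_boundedInverse h₁ _ x).2 rfl)
  simp only at hu hu'
  have := h₁.one_le u
  rw [hu, hu'] at this
  rwa [one_mul]

theorem le_re_inner_boundedInverse' {L₁ : H₁ →ₗ.[ℂ] H₁} (h₁ : IsSelfAdjointGeOne L₁) (x : H₁) :
    1 * ‖boundedInverse L₁ x‖ ^ 2 ≤ (⟪x, boundedInverse L₁ x⟫_ℂ).re := by
  have := le_re_inner_boundedInverse h₁ x
  have h2 := inner_re_symm (𝕜 := ℂ) (boundedInverse L₁ x) x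
  simp only [RCLike.re_to_complex] at h2
  linarith

theorem denseRange_boundedInverse {L₁ : H₁ →ₗ.[ℂ] H₁} (h₁ : IsSelfAdjointGeOne L₁) :
    DenseRange (boundedInverse L₁) := by
  refine h₁.selfAdjoint.dense_domain.mono fun x hx => ?_
  exact ⟨L₁ ⟨x, hx⟩, (isBoundedInverse_boundedInverse h₁ _ _).1 (L₁.mem_graph ⟨x, hx⟩)⟩

theorem le_re_inner_algTensorSum {L₁ : H₁ →ₗ.[ℂ] H₁} {L₂ : H₂ →ₗ.[ℂ] H₂}
    (h₁ : IsSelfAdjointGeOne L₁) (h₂ : IsSelfAdjointGeOne L₂)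
    {p : HilbertTensor H₁ H₂ × HilbertTensor H₁ H₂} (hp : p ∈ (algTensorSum L₁ L₂).graph) :
    1 * ‖p.1‖ ^ 2 ≤ (⟪p.1, p.2⟫_ℂ).re :=
  le_re_inner_of_mem_graph_algTensorSum
    (fun p hp => ((isBoundedInverse_boundedInverse h₁).mem_graph_iff p).1 hp)
    (fun p hp => ((isBoundedInverse_boundedInverse h₂).mem_graph_iff p).1 hp)
    (le_re_inner_boundedInverse h₁)
    (fun x => (by positivity : (0 : ℝ) ≤ _).trans (le_re_inner_boundedInverse h₂ x)) hp

theorem dense_domain_algTensorSum_of_selfAdjoint {L₁ : H₁ →ₗ.[ℂ] H₁} {L₂ : H₂ →ₗ.[ℂ] H₂}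
    (h₁ : IsSelfAdjointGeOne L₁) (h₂ : IsSelfAdjointGeOne L₂) :
    Dense ((algTensorSum L₁ L₂).domain : Set (HilbertTensor H₁ H₂)) :=
  dense_domain_algTensorSum
    (fun x => ((isBoundedInverse_boundedInverse h₁).mem_graph_iff _).2 ⟨x, rfl⟩)
    (fun x => ((isBoundedInverse_boundedInverse h₂).mem_graph_iff _).2 ⟨x, rfl⟩)
    (denseRange_boundedInverse h₁) (denseRange_boundedInverse h₂)

theorem isClosable_algTensorSum_of_selfAdjoint {L₁ : H₁ →ₗ.[ℂ] H₁} {L₂ : H₂ →ₗ.[ℂ] H₂}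
    (h₁ : IsSelfAdjointGeOne L₁) (h₂ : IsSelfAdjointGeOne L₂) :
    (algTensorSum L₁ L₂).IsClosable :=
  isClosable_of_accretive (dense_domain_algTensorSum_of_selfAdjoint h₁ h₂) fun _ hp =>
    (by positivity : (0 : ℝ) ≤ _).trans (le_re_inner_algTensorSum h₁ h₂ hp)

theorem mem_graph_algTensorSum_of_selfAdjoint {L₁ : H₁ →ₗ.[ℂ] H₁} {L₂ : H₂ →ₗ.[ℂ] H₂}
    (h₁ : IsSelfAdjointGeOne L₁) (h₂ : IsSelfAdjointGeOne L₂) (w : H₁ ⊗[ℂ] H₂) :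
    (tensorMap (boundedInverse L₁) (boundedInverse L₂) (toHilbertTensor H₁ H₂ w),
      (tensorMap (1 : H₁ →L[ℂ] H₁) (boundedInverse L₂) +
        tensorMap (boundedInverse L₁) (1 : H₂ →L[ℂ] H₂))
        (toHilbertTensor H₁ H₂ w)) ∈ (algTensorSum L₁ L₂).graph :=
  mem_graph_algTensorSum
    (fun x => ((isBoundedInverse_boundedInverse h₁).mem_graph_iff _).2 ⟨x, rfl⟩)
    (fun x => ((isBoundedInverse_boundedInverse h₂).mem_graph_iff _).2 ⟨x, rfl⟩) w

theorem isSelfAdjointGeOne_tensorSum {L₁ : H₁ →ₗ.[ℂ] H₁} {L₂ : H₂ →ₗ.[ℂ] H₂}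
    (h₁ : IsSelfAdjointGeOne L₁) (h₂ : IsSelfAdjointGeOne L₂) :
    IsSelfAdjointGeOne (tensorSum L₁ L₂) := by
  have hcl := isClosable_algTensorSum_of_selfAdjoint h₁ h₂
  have hone : ∀ u : (tensorSum L₁ L₂).domain,
      ‖(u : HilbertTensor H₁ H₂)‖ ^ 2 ≤ (⟪(u : HilbertTensor H₁ H₂), tensorSum L₁ L₂ u⟫_ℂ).re := by
    intro u
    have := le_re_inner_of_mem_graph_closure hcl
      (fun p hp => le_re_inner_algTensorSum h₁ h₂ hp) (LinearPMap.mem_graph _ u)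
    rwa [one_mul] at this
  have hdom := (dense_domain_algTensorSum_of_selfAdjoint h₁ h₂).mono
    (algTensorSum L₁ L₂).le_closure.1
  have s₁ : star (boundedInverse L₁) = boundedInverse L₁ :=
    (IsSelfAdjoint.of_nonneg (boundedInverse_nonneg h₁)).star_eq
  have s₂ : star (boundedInverse L₂) = boundedInverse L₂ :=
    (IsSelfAdjoint.of_nonneg (boundedInverse_nonneg h₂)).star_eq
  refine ⟨isSelfAdjoint_of_surjective hdom (fun u v => ?_) ?_, hone⟩
  · refine inner_symm_of_mem_graph_closure hcl (fun p hp q hq => ?_)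
      (LinearPMap.mem_graph _ u) (LinearPMap.mem_graph _ v)
    obtain ⟨w, rfl⟩ := exists_of_mem_graph_algTensorSum
      (fun p hp => ((isBoundedInverse_boundedInverse h₁).mem_graph_iff p).1 hp)
      (fun p hp => ((isBoundedInverse_boundedInverse h₂).mem_graph_iff p).1 hp) hp
    obtain ⟨z, rfl⟩ := exists_of_mem_graph_algTensorSum
      (fun p hp => ((isBoundedInverse_boundedInverse h₁).mem_graph_iff p).1 hp)
      (fun p hp => ((isBoundedInverse_boundedInverse h₂).mem_graph_iff p).1 hp) hq
    simp only
    refine inner_apply_comm_of_star_eq ?_ ?_ ?_ _ _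
    · rw [star_tensorMap, s₁, s₂]
    · rw [star_add, star_tensorMap, star_tensorMap, star_one, star_one, s₁, s₂]
    · simp only [add_mul, mul_add, ← tensorMap_mul, one_mul, mul_one]
  · have hs := surjective_of_isClosed (K := tensorSum L₁ L₂) hcl.closure_isClosed 0
      (fun u => ?_) ?_
    · simpa only [zero_smul, zero_add] using hs
    · rw [zero_smul, zero_add]
      have h3 := hone u
      have h4 : (⟪(u : HilbertTensor H₁ H₂), tensorSum L₁ L₂ u⟫_ℂ).re ≤
        ‖(u : HilbertTensor H₁ H₂)‖ * ‖tensorSum L₁ L₂ u‖ := re_inner_le_norm (𝕜 := ℂ) _ _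
      by_contra! h
      have h5 : 0 < ‖(u : HilbertTensor H₁ H₂)‖ := (norm_nonneg _).trans_lt h
      nlinarith
    -- The range of Λ is dense because Λ (Λ₁⁻¹ ⊗ Λ₂⁻¹) = 1 ⊗ Λ₂⁻¹ + Λ₁⁻¹ ⊗ 1 on algebraic tensors.
    · have hD := denseRange_tensorMap_add zero_lt_one (le_re_inner_boundedInverse' h₁)
        (boundedInverse_injective h₁)
        (fun x => (by positivity : (0 : ℝ) ≤ _).trans (le_re_inner_boundedInverse' h₂ x))
      refine (hD.comp denseRange_toHilbertTensor (ContinuousLinearMap.continuous _)).mono ?_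
      rintro _ ⟨w, rfl⟩
      obtain ⟨u, hu, hu'⟩ := LinearPMap.mem_graph_iff _ |>.1
        (mem_graph_closure (mem_graph_algTensorSum_of_selfAdjoint h₁ h₂ w))
      refine ⟨u, ?_⟩
      change (0 : ℂ) • (u : HilbertTensor H₁ H₂) + (algTensorSum L₁ L₂).closure u = _
      rw [hu', zero_smul, zero_add, add_comm, Function.comp_apply]

end TensorSum

/-! ### Von Neumann's inequality: from imaginary scalars to accretive matrices -/

section VonNeumann

variable {H : Type*} [NormedAddCommGroup H] [InnerProductSpace ℂ H]
variable {F : Type*} [NormedAddCommGroup F] [InnerProductSpace ℂ F]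

theorem differentiable_add_smul_add {E : Type*} [NormedAddCommGroup E] [NormedSpace ℂ E]
    (N₀ N₁ N₂ : E) : Differentiable ℂ fun z : ℂ => N₀ + (z • N₁ + N₂) := by
  fun_prop

theorem norm_sq_toHilbertTensor_sum {ι : Type*} [Fintype ι] (e : OrthonormalBasis ι ℂ F)
    (x : ι → H) : ‖toHilbertTensor H F (∑ j, x j ⊗ₜ[ℂ] e j)‖ ^ 2 = ∑ j, ‖x j‖ ^ 2 := by
  classical
  have h : ⟪∑ j, x j ⊗ₜ[ℂ] e j, ∑ j, x j ⊗ₜ[ℂ] e j⟫_ℂ = ((∑ j, ‖x j‖ ^ 2 : ℝ) : ℂ) := by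
    simp only [sum_inner, inner_sum, TensorProduct.inner_tmul,
      orthonormal_iff_ite.1 e.orthonormal, mul_ite, mul_one, mul_zero, Finset.sum_ite_eq',
      Finset.mem_univ, if_true, Complex.ofReal_sum]
    refine Finset.sum_congr rfl fun j _ => ?_
    rw [inner_self_eq_norm_sq_to_K]
    push_cast
    rfl
  rw [LinearIsometry.norm_map, ← inner_self_eq_norm_sq (𝕜 := ℂ), h, RCLike.re_to_complex,
    Complex.ofReal_re]

theorem exists_sum_tmul_basis {ι : Type*} [Fintype ι] (e : OrthonormalBasis ι ℂ F)
    (w : H ⊗[ℂ] F) : ∃ x : ι → H, w = ∑ j, x j ⊗ₜ[ℂ] e j := by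
  induction w with
  | zero => exact ⟨0, by simp⟩
  | add a b ha hb =>
    obtain ⟨x, rfl⟩ := ha
    obtain ⟨y, rfl⟩ := hb
    exact ⟨x + y, by simp [TensorProduct.add_tmul, Finset.sum_add_distrib]⟩
  | tmul x y =>
    refine ⟨fun j => e.repr y j • x, ?_⟩
    conv_lhs => rw [← e.sum_repr y, TensorProduct.tmul_sum]
    exact Finset.sum_congr rfl fun j _ => by rw [TensorProduct.tmul_smul, TensorProduct.smul_tmul']

variable [FiniteDimensional ℂ F]

/-- The estimate `‖S x‖ ≤ C ‖x + i μ G x‖` for real numbers `μ` extends to Hermitian matrices. -/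
theorem norm_tensorMap_le_of_isSymmetric {S G : H →L[ℂ] H} {C : ℝ} (hC : 0 ≤ C)
    (hS : ∀ (x : H) (μ : ℝ), ‖S x‖ ≤ C * ‖x + (Complex.I * μ) • G x‖) (B : F →L[ℂ] F)
    (hB : (B : F →ₗ[ℂ] F).IsSymmetric) (g : HilbertTensor H F) :
    ‖tensorMap S (1 : F →L[ℂ] F) g‖ ≤ C * ‖g + Complex.I • tensorMap G B g‖ := by
  refine denseRange_toHilbertTensor.induction_on g (isClosed_le
    (tensorMap S (1 : F →L[ℂ] F)).continuous.norm (continuous_const.mul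
      (continuous_id.add ((tensorMap G B).continuous.const_smul Complex.I)).norm)) fun w => ?_
  -- In an eigenbasis of B the operator 1 + i G ⊗ B splits into orthogonal blocks 1 + i β_j G, and
  -- the scalar estimate applies to each.
  let e := hB.eigenvectorBasis rfl
  let β := hB.eigenvalues rfl
  obtain ⟨x, rfl⟩ := exists_sum_tmul_basis e w
  have hBe : ∀ j, B (e j) = (β j : ℂ) • e j := fun j => hB.apply_eigenvectorBasis rfl j
  have e1 : tensorMap S (1 : F →L[ℂ] F) (toHilbertTensor H F (∑ j, x j ⊗ₜ[ℂ] e j)) =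
      toHilbertTensor H F (∑ j, S (x j) ⊗ₜ[ℂ] e j) := by
    simp only [map_sum, tensorMap_apply_tmul]
    rfl
  have e2 : toHilbertTensor H F (∑ j, x j ⊗ₜ[ℂ] e j) +
      Complex.I • tensorMap G B (toHilbertTensor H F (∑ j, x j ⊗ₜ[ℂ] e j)) =
      toHilbertTensor H F (∑ j, (x j + (Complex.I * β j) • G (x j)) ⊗ₜ[ℂ] e j) := by
    simp only [map_sum, tensorMap_apply_tmul, hBe, Finset.smul_sum, ← Finset.sum_add_distrib,
      ← map_smul, ← map_add]
    refine Finset.sum_congr rfl fun j _ => ?_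
    rw [TensorProduct.add_tmul, TensorProduct.tmul_smul, smul_smul, TensorProduct.smul_tmul',
      map_smul]
  rw [e1, e2]
  refine abs_le_of_sq_le_sq' ?_ (by positivity) |>.2
  rw [mul_pow, norm_sq_toHilbertTensor_sum, norm_sq_toHilbertTensor_sum, Finset.mul_sum]
  refine Finset.sum_le_sum fun j _ => ?_
  rw [← mul_pow]
  exact pow_le_pow_left₀ (norm_nonneg _) (hS (x j) (β j)) 2

variable [CompleteSpace H] [CompleteSpace F]

-- Put k = (G ⊗ 1) h and d = (1 + G ⊗ M) h = h + (1 ⊗ M) k. Accretivity gives c ‖k‖² ≤ Re ⟨k, d⟩,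
-- hence ‖k‖ ≤ ‖d‖ / c, and h = d - (1 ⊗ M) k. The bound is linear in ‖M‖, which later yields linear
-- growth in the half-plane.
omit [FiniteDimensional ℂ F] in
theorem norm_le_norm_one_add_tensorMap {G : H →L[ℂ] H} {c : ℝ} (hc : 0 < c)
    (hG : ∀ x, c * ‖G x‖ ^ 2 ≤ (⟪x, G x⟫_ℂ).re) {M : F →L[ℂ] F}
    (hM : ∀ f, 0 ≤ (⟪f, M f⟫_ℂ).re) (h : HilbertTensor H F) :
    ‖h‖ ≤ (1 + c⁻¹ * ‖M‖) * ‖(1 + tensorMap G M) h‖ := by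
  set k := tensorMap G (1 : F →L[ℂ] F) h
  have hk : tensorMap G M h = tensorMap (1 : H →L[ℂ] H) M k := by
    rw [← mul_apply_eq_comp, ← tensorMap_mul, one_mul, mul_one]
  have hD : (1 + tensorMap G M) h = h + tensorMap (1 : H →L[ℂ] H) M k := by
    rw [add_apply, hk]; rfl
  rw [hD]
  set d := h + tensorMap (1 : H →L[ℂ] H) M k with hd
  have h1 : c * ‖k‖ ^ 2 ≤ (⟪h, k⟫_ℂ).re := le_re_inner_tensorMap_one_right hG h
  have h2 : 0 ≤ (⟪k, tensorMap (1 : H →L[ℂ] H) M k⟫_ℂ).re := re_inner_tensorMap_one_left hM k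
  have h3 : (⟪k, d⟫_ℂ).re = (⟪h, k⟫_ℂ).re + (⟪k, tensorMap (1 : H →L[ℂ] H) M k⟫_ℂ).re := by
    rw [hd, inner_add_right, Complex.add_re]
    have := inner_re_symm (𝕜 := ℂ) k h
    simp only [RCLike.re_to_complex] at this
    rw [this]
  have h4 : (⟪k, d⟫_ℂ).re ≤ ‖k‖ * ‖d‖ := re_inner_le_norm (𝕜 := ℂ) _ _
  have h5 : ‖k‖ ≤ c⁻¹ * ‖d‖ := by
    rw [inv_mul_eq_div, le_div_iff₀ hc]
    by_contra! hlt
    have hk0 : 0 < ‖k‖ := by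
      by_contra! h0
      have : ‖k‖ = 0 := le_antisymm h0 (norm_nonneg _)
      rw [this, zero_mul] at hlt
      exact absurd hlt (not_lt.2 (norm_nonneg _))
    nlinarith
  have h6 : ‖tensorMap (1 : H →L[ℂ] H) M k‖ ≤ ‖M‖ * ‖k‖ := by
    refine (ContinuousLinearMap.le_opNorm _ _).trans
      (mul_le_mul_of_nonneg_right ((norm_tensorMap_le _ _).trans ?_) (norm_nonneg _))
    exact mul_le_of_le_one_left (norm_nonneg _) ContinuousLinearMap.norm_id_le
  calc ‖h‖ = ‖d - tensorMap (1 : H →L[ℂ] H) M k‖ := by rw [hd, add_sub_cancel_right]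
    _ ≤ ‖d‖ + ‖tensorMap (1 : H →L[ℂ] H) M k‖ := norm_sub_le _ _
    _ ≤ ‖d‖ + ‖M‖ * (c⁻¹ * ‖d‖) := by gcongr; exact h6.trans (by gcongr)
    _ = _ := by ring

-- The lower bound above leaves only density of the range. If h is in the kernel of the adjoint,
-- then h = -(G* ⊗ 1) k with k = (1 ⊗ M*) h. Now Re ⟨h, k⟩ is nonnegative since M* is accretive, and
-- at most -c ‖(G ⊗ 1) k‖², so k = 0 and h = 0.
omit [FiniteDimensional ℂ F] in
theorem isUnit_one_add_tensorMap {G : H →L[ℂ] H} {c : ℝ} (hc : 0 < c)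
    (hG : ∀ x, c * ‖G x‖ ^ 2 ≤ (⟪x, G x⟫_ℂ).re) (hGi : Function.Injective G) {M : F →L[ℂ] F}
    (hM : ∀ f, 0 ≤ (⟪f, M f⟫_ℂ).re) : IsUnit (1 + tensorMap G M) := by
  rw [ContinuousLinearMap.isUnit_iff_bijective,
    ContinuousLinearMap.bijective_iff_dense_range_and_antilipschitz]
  constructor
  · have hdense : DenseRange
        (1 + tensorMap G M : HilbertTensor H F →L[ℂ] HilbertTensor H F) := by
      rw [denseRange_iff_adjoint_injective, injective_iff_map_eq_zero]
      intro h hh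
      set k := tensorMap (1 : H →L[ℂ] H) M.adjoint h with hk
      have h1 : h = - tensorMap G.adjoint (1 : F →L[ℂ] F) k := by
        have e1 : (1 + tensorMap G M).adjoint h = h + tensorMap G.adjoint (1 : F →L[ℂ] F) k := by
          rw [← ContinuousLinearMap.star_eq_adjoint, star_add, star_tensorMap, star_one, hk,
            ← mul_apply_eq_comp, ← tensorMap_mul, one_mul, mul_one]
          rfl
        rw [e1] at hh
        exact eq_neg_of_add_eq_zero_left hh
      have h2 : 0 ≤ (⟪h, k⟫_ℂ).re := by
        refine re_inner_tensorMap_one_left (fun f => ?_) h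
        rw [ContinuousLinearMap.adjoint_inner_right]
        have := inner_re_symm (𝕜 := ℂ) f (M f)
        simp only [RCLike.re_to_complex] at this
        rw [← this]
        exact hM f
      have h3 : (⟪h, k⟫_ℂ).re = -(⟪k, tensorMap G (1 : F →L[ℂ] F) k⟫_ℂ).re := by
        conv_lhs => rw [h1]
        have e2 : tensorMap G.adjoint (1 : F →L[ℂ] F) =
            (tensorMap G (1 : F →L[ℂ] F)).adjoint := by
          rw [adjoint_tensorMap, ← ContinuousLinearMap.star_eq_adjoint (1 : F →L[ℂ] F), star_one]
        rw [inner_neg_left, Complex.neg_re, e2, ContinuousLinearMap.adjoint_inner_left]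
      have h4 := le_re_inner_tensorMap_one_right hG k
      have h7 : ‖tensorMap G (1 : F →L[ℂ] F) k‖ ^ 2 ≤ 0 := by nlinarith
      have h8 : tensorMap G (1 : F →L[ℂ] F) k = 0 := by
        rw [← norm_eq_zero]
        exact pow_eq_zero_iff two_ne_zero |>.1 (le_antisymm h7 (sq_nonneg _))
      have h9 := (map_eq_zero_iff _ (tensorMap_injective hGi (fun _ _ h => h))).1 h8
      rw [h1, h9, map_zero, neg_zero]
    rw [← Submodule.dense_iff_topologicalClosure_eq_top]
    exact hdense
  · refine ⟨⟨1 + c⁻¹ * ‖M‖, by positivity⟩, ?_⟩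
    exact ContinuousLinearMap.antilipschitz_of_bound _ fun h =>
      norm_le_norm_one_add_tensorMap hc hG hM h

/-- Von Neumann's inequality for an accretive matrix `M`: the estimate `‖S x‖ ≤ C ‖x + i μ G x‖`
for real numbers `μ` extends to accretive matrices `M` in place of `i μ`. -/
theorem norm_tensorMap_le_of_accretive {S G : H →L[ℂ] H} {C : ℝ} (hC : 0 ≤ C)
    (hS : ∀ (x : H) (μ : ℝ), ‖S x‖ ≤ C * ‖x + (Complex.I * μ) • G x‖) {c : ℝ} (hc : 0 < c)
    (hG : ∀ x, c * ‖G x‖ ^ 2 ≤ (⟪x, G x⟫_ℂ).re) (hGi : Function.Injective G) {M : F →L[ℂ] F}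
    (hM : ∀ f, 0 ≤ (⟪f, M f⟫_ℂ).re) (g : HilbertTensor H F) :
    ‖tensorMap S (1 : F →L[ℂ] F) g‖ ≤ C * ‖(1 + tensorMap G M) g‖ := by
  let A : F →L[ℂ] F := (1 / 2 : ℂ) • (M + star M)
  let B : F →L[ℂ] F := (-Complex.I / 2) • (M - star M)
  have hAB : M = A + Complex.I • B := by
    simp only [A, B, smul_smul]
    rw [show Complex.I * (-Complex.I / 2) = 1 / 2 by
      rw [mul_div_assoc', mul_neg, Complex.I_mul_I]; norm_num]
    module
  have hA : ∀ f, 0 ≤ (⟪f, A f⟫_ℂ).re := by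
    intro f
    have h1 := re_inner_nonneg_of_nonneg (re_inner_nonneg_iff.1 hM) f
    simp only [A]
    rw [smul_apply, inner_smul_right, show (1 / 2 : ℂ) = ((1 / 2 : ℝ) : ℂ) by norm_num,
      Complex.re_ofReal_mul]
    positivity
  have hAsa : star A = A := by
    simp only [A]
    rw [star_smul, star_add, star_star, add_comm]
    congr 1
    norm_num
  have hBsa : star B = B := by
    simp only [B]
    rw [star_smul, star_sub, star_star, ← neg_sub M, smul_neg, ← neg_smul]
    congr 1
    simp [neg_div]
  have hsymm : ∀ X : F →L[ℂ] F, star X = X → (X : F →ₗ[ℂ] F).IsSymmetric := fun X hX =>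
    ContinuousLinearMap.isSelfAdjoint_iff_isSymmetric.1 hX
  have hIB : ∀ f, (⟪f, (Complex.I • B) f⟫_ℂ).re = 0 := by
    intro f
    have h1 : (starRingEnd ℂ) ⟪f, B f⟫_ℂ = ⟪f, B f⟫_ℂ := by
      rw [inner_conj_symm]; exact hsymm B hBsa f f
    rw [smul_apply, inner_smul_right, Complex.I_mul_re, Complex.conj_eq_iff_im.1 h1, neg_zero]
  -- Only the Hermitian part A ≥ 0 receives the parameter: the result is accretive for Re z ≥ 0, is
  -- i times a Hermitian matrix for imaginary z, and equals M at z = 1.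
  let Mz : ℂ → F →L[ℂ] F := fun z => z • A + Complex.I • B
  have hMz : ∀ z : ℂ, 0 ≤ z.re → ∀ f, 0 ≤ (⟪f, Mz z f⟫_ℂ).re := by
    intro z hz f
    have h1 : (starRingEnd ℂ) ⟪f, A f⟫_ℂ = ⟪f, A f⟫_ℂ := by
      rw [inner_conj_symm]; exact hsymm A hAsa f f
    have h2 : (⟪f, Mz z f⟫_ℂ).re = z.re * (⟪f, A f⟫_ℂ).re := by
      simp only [Mz]
      rw [add_apply, inner_add_right, Complex.add_re, hIB, smul_apply, inner_smul_right,
        Complex.mul_re, Complex.conj_eq_iff_im.1 h1]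
      ring
    rw [h2]
    exact mul_nonneg hz (hA f)
  let D : ℂ → HilbertTensor H F →L[ℂ] HilbertTensor H F := fun z => 1 + tensorMap G (Mz z)
  have hDeq : ∀ z, D z = 1 + (z • tensorMap G A + Complex.I • tensorMap G B) := fun z => by
    simp only [D, Mz, tensorMap_add_right, tensorMap_smul_right]
  have hDd : Differentiable ℂ D := by
    rw [show D = _ from funext hDeq]
    exact differentiable_add_smul_add 1 (tensorMap G A) (Complex.I • tensorMap G B)
  have hDu : ∀ z : ℂ, 0 ≤ z.re → IsUnit (D z) := fun z hz =>
    isUnit_one_add_tensorMap hc hG hGi (hMz z hz)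
  set S' := tensorMap S (1 : F →L[ℂ] F)
  set x := (1 + tensorMap G M) g with hx
  have hDinv : ∀ z : ℂ, 0 ≤ z.re → D z (Ring.inverse (D z) x) = x := fun z hz => by
    rw [← mul_apply_eq_comp, Ring.mul_inverse_cancel _ (hDu z hz)]; rfl
  let f : ℂ → HilbertTensor H F := fun z => S' (Ring.inverse (D z) x)
  have hf1 : f 1 = S' g := by
    have h1 : D 1 = 1 + tensorMap G M := by simp only [D, Mz, one_smul, ← hAB]
    refine congrArg S' ?_
    rw [hx, ← h1, ← mul_apply_eq_comp, Ring.inverse_mul_cancel _ (hDu 1 (by simp))]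
    rfl
  have hfd : ∀ z : ℂ, 0 ≤ z.re → DifferentiableAt ℂ f z := fun z hz =>
    S'.differentiableAt.comp z
      (((hDd z).inverse (hDu z hz)).clm_apply (differentiableAt_const x))
  obtain ⟨a, b, ha, hb, hgrowth⟩ : ∃ a b : ℝ, 0 ≤ a ∧ 0 ≤ b ∧
      ∀ z : ℂ, 0 ≤ z.re → ‖f z‖ ≤ a + b * ‖z‖ := by
    refine ⟨‖S'‖ * ((1 + c⁻¹ * ‖B‖) * ‖x‖), ‖S'‖ * (c⁻¹ * ‖A‖ * ‖x‖), by positivity,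
      by positivity, fun z hz => ?_⟩
    have h1 := norm_le_norm_one_add_tensorMap hc hG (hMz z hz) (Ring.inverse (D z) x)
    change _ ≤ _ * ‖D z _‖ at h1
    rw [hDinv z hz] at h1
    have h2 : ‖Mz z‖ ≤ ‖z‖ * ‖A‖ + ‖B‖ := by
      refine (norm_add_le _ _).trans ?_
      rw [norm_smul z A, norm_smul Complex.I B, Complex.norm_I, one_mul]
    calc ‖f z‖ ≤ ‖S'‖ * ‖Ring.inverse (D z) x‖ := S'.le_opNorm _
      _ ≤ ‖S'‖ * ((1 + c⁻¹ * (‖z‖ * ‖A‖ + ‖B‖)) * ‖x‖) := by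
        gcongr
        exact h1.trans (by gcongr)
      _ = _ := by ring
  have him : ∀ y : ℝ, ‖f (y * Complex.I)‖ ≤ C * ‖x‖ := by
    intro y
    have hz : 0 ≤ ((y : ℂ) * Complex.I).re := by simp
    have h1 := norm_tensorMap_le_of_isSymmetric hC hS ((y : ℂ) • A + B) (by
      refine hsymm _ ?_
      rw [star_add, star_smul, hAsa, hBsa]
      simp) (Ring.inverse (D (y * Complex.I)) x)
    refine h1.trans_eq ?_
    congr 2
    conv_rhs => rw [← hDinv _ hz]
    simp only [D, Mz]
    rw [add_apply, ← smul_apply, ← tensorMap_smul_right]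
    congr 3
    rw [smul_add, smul_smul, mul_comm]
  -- Phragmén–Lindelöf needs boundedness along the real axis, but f is only known to grow at most
  -- linearly. In the half-plane |1 + εz| ≥ max(1, ε|z|), so division by 1 + εz restores boundedness
  -- and keeps the bound on the imaginary axis; ε tends to 0 at the end.
  have main : ∀ ε : ℝ, 0 < ε → ‖((1 + ε * (1 : ℂ))⁻¹ : ℂ) • f 1‖ ≤ C * ‖x‖ := by
    intro ε hε
    have hne : ∀ z : ℂ, 0 ≤ z.re → 1 ≤ ‖1 + ε * z‖ ∧ ε * ‖z‖ ≤ ‖1 + ε * z‖ := by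
      intro z hz
      have h0 : ‖(1 : ℂ) + ε * z‖ ^ 2 = 1 + 2 * (ε * z.re) + (ε * ‖z‖) ^ 2 := by
        have : ‖(ε : ℂ) * z‖ = ε * ‖z‖ := by rw [norm_mul, Complex.norm_real, 
            Real.norm_of_nonneg hε.le]
        rw [← this, Complex.sq_norm, Complex.sq_norm, Complex.normSq_add]
        simp
        ring
      have hz' : 0 ≤ ε * z.re := by positivity
      constructor
      · refine abs_le_of_sq_le_sq' ?_ (norm_nonneg _) |>.2
        rw [h0]; nlinarith [sq_nonneg (ε * ‖z‖)]
      · refine abs_le_of_sq_le_sq' ?_ (norm_nonneg _) |>.2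
        rw [h0]; nlinarith
    have hbd : ∀ z : ℂ, 0 ≤ z.re → ‖((1 + ε * z)⁻¹ : ℂ) • f z‖ ≤ a + b / ε := by
      intro z hz
      obtain ⟨h1, h2⟩ := hne z hz
      rw [norm_smul, norm_inv, inv_mul_le_iff₀ (by linarith)]
      refine (hgrowth z hz).trans ?_
      have h3 : ‖z‖ ≤ ‖1 + ε * z‖ / ε := by rw [le_div_iff₀ hε]; linarith
      calc a + b * ‖z‖ ≤ ‖1 + ε * z‖ * a + b * (‖1 + ε * z‖ / ε) := by
            gcongr
            exact le_mul_of_one_le_left ha h1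
        _ = _ := by ring
    refine PhragmenLindelof.right_half_plane_of_bounded_on_real
      (f := fun z : ℂ => ((1 + ε * z)⁻¹ : ℂ) • f z) ?_ ?_ ?_ ?_ (z := 1) (by simp)
    · refine DifferentiableOn.diffContOnCl fun z hz => ?_
      rw [Complex.closure_setOfPred_lt_re] at hz
      have hz' : 0 ≤ z.re := hz
      refine DifferentiableAt.differentiableWithinAt (DifferentiableAt.fun_smul ?_ (hfd z hz'))
      refine DifferentiableAt.fun_inv (by fun_prop) fun h0 => ?_
      have := (hne z hz').1
      rw [h0, norm_zero] at this
      linarith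
    · refine ⟨0, by norm_num, 0, ?_⟩
      refine Asymptotics.IsBigO.of_bound (a + b / ε) ?_
      rw [Filter.eventually_inf_principal]
      refine Filter.Eventually.of_forall fun z hz => ?_
      have hz' : 0 < z.re := hz
      simpa using hbd z hz'.le
    · refine Filter.isBoundedUnder_of_eventually_le (a := a + b / ε) ?_
      filter_upwards [Filter.eventually_ge_atTop 0] with y hy
      exact hbd y (by simpa using hy)
    · intro y
      rw [norm_smul, norm_inv]
      have h1 := (hne (y * Complex.I) (by simp)).1
      exact (mul_le_of_le_one_left (norm_nonneg _) (inv_le_one_of_one_le₀ h1)).trans (him y)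
  rw [← hf1]
  have hlim : Filter.Tendsto (fun ε : ℝ => ‖((1 + ε * (1 : ℂ))⁻¹ : ℂ) • f 1‖)
      (nhdsWithin 0 (Set.Ioi 0)) (nhds ‖f 1‖) := by
    have : ContinuousAt (fun ε : ℝ => ‖((1 + ε * (1 : ℂ))⁻¹ : ℂ) • f 1‖) 0 := by
      have hc : ContinuousAt (fun ε : ℝ => (1 + ε * (1 : ℂ))⁻¹) 0 :=
        ContinuousAt.inv₀ (f := fun ε : ℝ => 1 + ε * (1 : ℂ)) (by fun_prop) (by simp)
      exact (hc.smul continuousAt_const).norm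
    have h2 := this.tendsto
    simp only [Complex.ofReal_zero, zero_mul, add_zero, inv_one, one_smul] at h2
    exact h2.mono_left nhdsWithin_le_nhds
  refine le_of_tendsto hlim ?_
  filter_upwards [self_mem_nhdsWithin] with ε hε
  exact main ε hε

end VonNeumann

/-! ### From accretive matrices to unbounded accretive operators -/

section Compression

variable {H₁ : Type*} [NormedAddCommGroup H₁] [InnerProductSpace ℂ H₁] [CompleteSpace H₁]
variable {H₂ : Type*} [NormedAddCommGroup H₂] [InnerProductSpace ℂ H₂]

theorem norm_tensorMap_one_apply_le {E F G : Type*} [NormedAddCommGroup E] [InnerProductSpace ℂ E]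
    [NormedAddCommGroup F] [InnerProductSpace ℂ F] [NormedAddCommGroup G] [InnerProductSpace ℂ G]
    {B : F →L[ℂ] G} (hB : ‖B‖ ≤ 1) (g : HilbertTensor E F) :
    ‖tensorMap (1 : E →L[ℂ] E) B g‖ ≤ ‖g‖ := by
  refine (ContinuousLinearMap.le_opNorm _ _).trans (mul_le_of_le_one_left (norm_nonneg _) ?_)
  exact (norm_tensorMap_le _ _).trans
    (mul_le_one₀ ContinuousLinearMap.norm_id_le (norm_nonneg _) hB)

/-- Von Neumann's inequality for an accretive operator `X P⁻¹`: the estimate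
`‖S x‖ ≤ C ‖x + i μ G x‖` for real numbers `μ` extends to accretive operators in place of `i μ`. -/
theorem norm_tensorMap_le_of_re_inner_nonneg {S G : H₁ →L[ℂ] H₁} {C : ℝ} (hC : 0 ≤ C)
    (hS : ∀ (x : H₁) (μ : ℝ), ‖S x‖ ≤ C * ‖x + (Complex.I * μ) • G x‖) {c : ℝ} (hc : 0 < c)
    (hG : ∀ x, c * ‖G x‖ ^ 2 ≤ (⟪x, G x⟫_ℂ).re) (hGi : Function.Injective G)
    {P X : H₂ →L[ℂ] H₂} (hP : Function.Injective P) (hPX : ∀ y, 0 ≤ (⟪P y, X y⟫_ℂ).re)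
    (g : HilbertTensor H₁ H₂) :
    ‖tensorMap S P g‖ ≤ C * ‖tensorMap (1 : H₁ →L[ℂ] H₁) P g + tensorMap G X g‖ := by
  refine denseRange_toHilbertTensor.induction_on g (isClosed_le
    (tensorMap S P).continuous.norm (continuous_const.mul
      ((tensorMap _ P).continuous.add (tensorMap G X).continuous).norm)) fun w => ?_
  -- An algebraic tensor lives in H₁ ⊗ Y with Y finite-dimensional. On F = P Y the operator X P⁻¹
  -- compresses to M = p X P⁻¹, with p the projection onto F. It stays accretive because ⟨P y, p X
  -- y⟩ = ⟨P y, X y⟩, and p being a contraction the matrix estimate for M suffices.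
  obtain ⟨Y, hYfin, hY⟩ := TensorProduct.exists_finite_submodule_right_of_setFinite {w}
    (Set.finite_singleton w)
  obtain ⟨w', rfl⟩ := hY rfl
  let F : Submodule ℂ H₂ := Y.map (P : H₂ →ₗ[ℂ] H₂)
  have : FiniteDimensional ℂ F := inferInstance
  have : CompleteSpace F := FiniteDimensional.complete ℂ F
  let e : Y ≃ₗ[ℂ] F := Submodule.equivMapOfInjective (P : H₂ →ₗ[ℂ] H₂) hP Y
  let e' : Y →L[ℂ] F := LinearMap.toContinuousLinearMap e.toLinearMap
  let p : H₂ →L[ℂ] F := F.orthogonalProjectionOnto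
  let M : F →L[ℂ] F := p ∘L X ∘L Y.subtypeL ∘L LinearMap.toContinuousLinearMap e.symm.toLinearMap
  have he : ∀ y : Y, (e' y : H₂) = P y := fun y => rfl
  have hMe : ∀ y : Y, M (e' y) = p (X y) := fun y => by
    change p (X (e.symm (e y))) = _
    rw [e.symm_apply_apply]
  have hM : ∀ f, 0 ≤ (⟪f, M f⟫_ℂ).re := by
    intro f
    obtain ⟨y, rfl⟩ := e.surjective f
    change 0 ≤ (⟪e' y, M (e' y)⟫_ℂ).re
    rw [hMe, Submodule.inner_orthogonalProjectionOnto_eq_of_mem_left, he]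
    exact hPX y
  have hw : toHilbertTensor H₁ H₂ ((Y.subtype.lTensor H₁) w') =
      tensorMap 1 Y.subtypeL (toHilbertTensor H₁ Y w') := by
    rw [tensorMap_apply_coe]
    congr 1
    rw [TensorProduct.mapL_apply]
    rfl
  rw [hw]
  set v := toHilbertTensor H₁ Y w'
  have e1 : tensorMap S P (tensorMap 1 Y.subtypeL v) =
      tensorMap 1 F.subtypeL (tensorMap S (1 : F →L[ℂ] F) (tensorMap 1 e' v)) := by
    simp only [← ContinuousLinearMap.comp_apply, ← tensorMap_comp]
    congr 2
  have e2 : (1 + tensorMap G M) (tensorMap 1 e' v) =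
      tensorMap 1 p (tensorMap (1 : H₁ →L[ℂ] H₁) P (tensorMap 1 Y.subtypeL v) +
        tensorMap G X (tensorMap 1 Y.subtypeL v)) := by
    simp only [add_apply, map_add]
    rw [one_apply_eq_self]
    simp only [← ContinuousLinearMap.comp_apply, ← tensorMap_comp]
    congr 3
    · ext y
      change (e' y : H₂) = p (P y)
      rw [← he]
      exact congrArg _ (F.orthogonalProjectionOnto_mem_subspace_eq_self (e' y)).symm
    · ext y
      exact congrArg _ (hMe y)
  rw [e1]
  calc _ ≤ ‖tensorMap S (1 : F →L[ℂ] F) (tensorMap 1 e' v)‖ :=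
        norm_tensorMap_one_apply_le F.norm_subtypeL_le _
    _ ≤ C * ‖(1 + tensorMap G M) (tensorMap 1 e' v)‖ :=
        norm_tensorMap_le_of_accretive hC hS hc hG hGi hM _
    _ ≤ _ := by
        rw [e2]
        gcongr
        exact norm_tensorMap_one_apply_le F.orthogonalProjectionOnto_norm_le _

end Compression

/-! ### Fractional powers of a sum of commuting operators -/

section CommutingPowers

open scoped ComplexStarModule

variable {E : Type*} [NormedAddCommGroup E] [InnerProductSpace ℂ E] [CompleteSpace E]

/-- With k = √(h² - f²), the functional calculus gives ‖h(x) g‖² = ‖f(x) g‖² + ‖k(x) g‖². -/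
theorem norm_cfc_apply_le {x : E →L[ℂ] E} [IsStarNormal x] {f h : ℂ → ℝ}
    (hf : ContinuousOn f (spectrum ℂ x)) (hh : ContinuousOn h (spectrum ℂ x))
    (h0 : ∀ z ∈ spectrum ℂ x, 0 ≤ f z) (hfh : ∀ z ∈ spectrum ℂ x, f z ≤ h z) (g : E) :
    ‖cfc (fun z => (f z : ℂ)) x g‖ ≤ ‖cfc (fun z => (h z : ℂ)) x g‖ := by
  let k : ℂ → ℝ := fun z => Real.sqrt (h z ^ 2 - f z ^ 2)
  have hk : ContinuousOn k (spectrum ℂ x) := ((hh.pow 2).sub (hf.pow 2)).sqrt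
  have hc : ∀ φ : ℂ → ℝ, ContinuousOn φ (spectrum ℂ x) →
      ContinuousOn (fun z => (φ z : ℂ)) (spectrum ℂ x) := fun φ hφ =>
    Complex.continuous_ofReal.comp_continuousOn hφ
  have hsq : ∀ φ : ℂ → ℝ, ContinuousOn φ (spectrum ℂ x) →
      ⟪g, cfc (fun z => (φ z : ℂ) * (φ z : ℂ)) x g⟫_ℂ =
        ((‖cfc (fun z => (φ z : ℂ)) x g‖ ^ 2 : ℝ) : ℂ) := fun φ hφ => by
    have h1 : star (cfc (fun z => (φ z : ℂ)) x) = cfc (fun z => (φ z : ℂ)) x := by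
      rw [← cfc_star]
      simp
    rw [cfc_mul _ _ x (hc φ hφ) (hc φ hφ), mul_apply_eq_comp,
      ← ContinuousLinearMap.adjoint_inner_left, ← ContinuousLinearMap.star_eq_adjoint, h1,
      inner_self_eq_norm_sq_to_K]
    push_cast
    rfl
  have h2 : cfc (fun z => (h z : ℂ) * (h z : ℂ)) x =
      cfc (fun z => (f z : ℂ) * (f z : ℂ)) x + cfc (fun z => (k z : ℂ) * (k z : ℂ)) x := by
    have hc2 : ∀ φ : ℂ → ℝ, ContinuousOn φ (spectrum ℂ x) →
        ContinuousOn (fun z => (φ z : ℂ) * (φ z : ℂ)) (spectrum ℂ x) := fun φ hφ =>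
      (hc φ hφ).mul (hc φ hφ)
    rw [← cfc_add x _ _ (hc2 f hf) (hc2 k hk)]
    refine cfc_congr fun z hz => ?_
    have h3 : k z * k z = h z ^ 2 - f z ^ 2 :=
      Real.mul_self_sqrt (by nlinarith [h0 z hz, hfh z hz])
    have h4 : h z * h z = f z * f z + k z * k z := by rw [h3]; ring
    exact_mod_cast h4
  have h5 : ‖cfc (fun z => (h z : ℂ)) x g‖ ^ 2 =
      ‖cfc (fun z => (f z : ℂ)) x g‖ ^ 2 + ‖cfc (fun z => (k z : ℂ)) x g‖ ^ 2 := by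
    have h6 := hsq h hh
    rw [h2, add_apply, inner_add_right, hsq f hf, hsq k hk] at h6
    exact_mod_cast h6.symm
  refine abs_le_of_sq_le_sq' ?_ (norm_nonneg _) |>.2
  rw [h5]
  linarith [sq_nonneg ‖cfc (fun z => (k z : ℂ)) x g‖]

theorem rpow_cfc {x : E →L[ℂ] E} [IsStarNormal x] {φ : ℂ → ℝ}
    (hφ : ContinuousOn φ (spectrum ℂ x)) {p : ℝ} (hp : 0 < p)
    (ha : 0 ≤ cfc (fun z => (φ z : ℂ)) x) :
    cfc (fun z => (φ z : ℂ)) x ^ p = cfc (fun z => ((φ z ^ p : ℝ) : ℂ)) x := by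
  have hφ' : ContinuousOn (fun z => (φ z : ℂ)) (spectrum ℂ x) :=
    Complex.continuous_ofReal.comp_continuousOn hφ
  rw [CFC.rpow_eq_cfc_real (ha := ha),
    cfc_real_eq_complex _ (ha := IsSelfAdjoint.of_nonneg ha), ← cfc_comp' _ _ x ?_ hφ']
  · simp
  · refine Complex.continuous_ofReal.comp_continuousOn (ContinuousOn.rpow_const ?_ ?_)
    · exact Complex.continuous_re.continuousOn
    · exact fun _ _ => Or.inr hp.le

/-- For positive a and b, division by ab turns this into (α + β)^(1-p) ≤ α^(1-p) + β^(1-p) with α =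
1/a, β = 1/b. The form without inverses also covers 0, which may lie in the spectrum of a bounded
inverse. -/
theorem rpow_mul_add_le {a b p : ℝ} (ha : 0 ≤ a) (hb : 0 ≤ b) (h0 : 0 < p) (h1 : p < 1) :
    (a * b / (a + b)) ^ p * (a + b) ≤ a ^ p * b + a * b ^ p := by
  rcases ha.eq_or_lt with rfl | ha
  · rw [zero_mul, zero_div, Real.zero_rpow h0.ne']; simp
  rcases hb.eq_or_lt with rfl | hb
  · rw [mul_zero, zero_div, Real.zero_rpow h0.ne']; simp
  have hab : 0 < a + b := by positivity
  have hone : ∀ t : ℝ, 0 < t → t = t ^ p * t ^ (1 - p) := fun t ht => by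
    rw [← Real.rpow_add ht]; simp
  have h2 := Real.rpow_add_le_add_rpow ha.le hb.le (p := 1 - p) (by linarith) (by linarith)
  have h3 : (a * b / (a + b)) ^ p * (a + b) = a ^ p * b ^ p * (a + b) ^ (1 - p) := by
    rw [Real.div_rpow (by positivity) hab.le, Real.mul_rpow ha.le hb.le]
    nth_rewrite 2 [hone (a + b) hab]
    have : (a + b) ^ p ≠ 0 := by positivity
    field_simp
  rw [h3]
  calc a ^ p * b ^ p * (a + b) ^ (1 - p) ≤ a ^ p * b ^ p * (a ^ (1 - p) + b ^ (1 - p)) := by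
        gcongr
    _ = a ^ p * (b ^ p * b ^ (1 - p)) + (a ^ p * a ^ (1 - p)) * b ^ p := by ring
    _ = _ := by rw [← hone a ha, ← hone b hb]

/-- At the origin, where the quotient is 0 by convention, continuity follows from 0 ≤ ab / (a + b) ≤
a. -/
theorem continuousOn_mul_div_add :
    ContinuousOn (fun z : ℂ => z.re * z.im / (z.re + z.im)) {z | 0 ≤ z.re ∧ 0 ≤ z.im} := by
  intro z hz
  by_cases h : z.re + z.im = 0
  · have hre : z.re = 0 := by linarith [hz.1, hz.2]
    have h0 : z.re * z.im / (z.re + z.im) = 0 := by rw [h, div_zero]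
    rw [ContinuousWithinAt, h0]
    have hlim : Filter.Tendsto (fun w : ℂ => w.re) (nhdsWithin z {z | 0 ≤ z.re ∧ 0 ≤ z.im})
        (nhds 0) := by
      have := (Complex.continuous_re.tendsto z).mono_left
        (nhdsWithin_le_nhds (s := {z | 0 ≤ z.re ∧ 0 ≤ z.im}))
      rwa [hre] at this
    refine tendsto_of_tendsto_of_tendsto_of_le_of_le' tendsto_const_nhds hlim ?_ ?_
    · filter_upwards [self_mem_nhdsWithin] with w hw
      exact div_nonneg (mul_nonneg hw.1 hw.2) (add_nonneg hw.1 hw.2)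
    · filter_upwards [self_mem_nhdsWithin] with w hw
      refine div_le_of_le_mul₀ (add_nonneg hw.1 hw.2) hw.1 ?_
      nlinarith [mul_nonneg hw.1 hw.1]
  · refine ContinuousAt.continuousWithinAt (ContinuousAt.div ?_ ?_ h)
    · exact (Complex.continuous_re.mul Complex.continuous_im).continuousAt
    · exact (Complex.continuous_re.add Complex.continuous_im).continuousAt

/-- If `a₁`, `a₂`, `A` are the inverses of `Λ₁`, `Λ₂`, `Λ₁ + Λ₂`, this is the inequality
`‖(Λ₁ + Λ₂) ^ r u‖ ≤ ‖Λ₁ ^ r u‖ + ‖Λ₂ ^ r u‖` with `p = 1 - r` and `u = a₁ a₂ g`. -/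
theorem norm_rpow_apply_le {a₁ a₂ A : E →L[ℂ] E} (h₁ : 0 ≤ a₁) (h₂ : 0 ≤ a₂) (hA : 0 ≤ A)
    (hcomm : a₁ * a₂ = a₂ * a₁) (hAb : A * (a₁ + a₂) = a₁ * a₂) (hd : DenseRange (a₁ + a₂))
    {p : ℝ} (hp0 : 0 < p) (hp1 : p < 1) (g : E) :
    ‖(A ^ p) ((a₁ + a₂) g)‖ ≤ ‖(a₁ ^ p) (a₂ g)‖ + ‖a₁ ((a₂ ^ p) g)‖ := by
  have s₁ := IsSelfAdjoint.of_nonneg h₁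
  have s₂ := IsSelfAdjoint.of_nonneg h₂
  -- The joint functional calculus of the commuting pair is that of one normal operator, with
  -- spectrum in the closed first quadrant.
  set x : E →L[ℂ] E := a₁ + Complex.I • a₂ with hx
  have hre : (ℜ x : E →L[ℂ] E) = a₁ := by
    rw [hx, map_add, realPart_I_smul, s₂.imaginaryPart]
    simp [s₁.coe_realPart]
  have him : (ℑ x : E →L[ℂ] E) = a₂ := by
    rw [hx, map_add, imaginaryPart_I_smul, s₁.imaginaryPart]
    simp [s₂.coe_realPart]
  have hnormal : IsStarNormal x := by
    rw [isStarNormal_iff_commute_realPart_imaginaryPart, hre, him]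
    exact hcomm
  have c₁ : cfc (fun z : ℂ => (z.re : ℂ)) x = a₁ := by rw [cfc_re_id x, hre]
  have c₂ : cfc (fun z : ℂ => (z.im : ℂ)) x = a₂ := by rw [cfc_im_id x, him]
  have q₁ : ∀ z ∈ spectrum ℂ x, 0 ≤ z.re := fun z hz => by
    refine spectrum_nonneg_of_nonneg (𝕜 := ℝ) h₁ ?_
    rw [← hre, spectrum_realPart' x]
    exact ⟨z, hz, rfl⟩
  have q₂ : ∀ z ∈ spectrum ℂ x, 0 ≤ z.im := fun z hz => by
    refine spectrum_nonneg_of_nonneg (𝕜 := ℝ) h₂ ?_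
    rw [← him, spectrum_imaginaryPart' x]
    exact ⟨z, hz, rfl⟩
  let φ : ℂ → ℝ := fun z => z.re * z.im / (z.re + z.im)
  have hφ : ContinuousOn φ (spectrum ℂ x) :=
    continuousOn_mul_div_add.mono fun z hz => ⟨q₁ z hz, q₂ z hz⟩
  have hφ0 : ∀ z ∈ spectrum ℂ x, 0 ≤ φ z := fun z hz =>
    div_nonneg (mul_nonneg (q₁ z hz) (q₂ z hz)) (add_nonneg (q₁ z hz) (q₂ z hz))
  have hc : ∀ ψ : ℂ → ℝ, ContinuousOn ψ (spectrum ℂ x) →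
      ContinuousOn (fun z => (ψ z : ℂ)) (spectrum ℂ x) := fun ψ hψ =>
    Complex.continuous_ofReal.comp_continuousOn hψ
  have cre : ContinuousOn (fun z : ℂ => z.re) (spectrum ℂ x) := Complex.continuous_re.continuousOn
  have cim : ContinuousOn (fun z : ℂ => z.im) (spectrum ℂ x) := Complex.continuous_im.continuousOn
  have cadd : ContinuousOn (fun z : ℂ => z.re + z.im) (spectrum ℂ x) := cre.add cim
  have cb : cfc (fun z : ℂ => ((z.re + z.im : ℝ) : ℂ)) x = a₁ + a₂ := by
    rw [← c₁, ← c₂, ← cfc_add x _ _ (hc _ cre) (hc _ cim)]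
    simp
  have cmul : ∀ ψ χ : ℂ → ℝ, ContinuousOn ψ (spectrum ℂ x) → ContinuousOn χ (spectrum ℂ x) →
      cfc (fun z => (ψ z : ℂ)) x * cfc (fun z => (χ z : ℂ)) x =
        cfc (fun z => ((ψ z * χ z : ℝ) : ℂ)) x := fun ψ χ hψ hχ => by
    rw [← cfc_mul _ _ x (hc ψ hψ) (hc χ hχ)]
    simp
  -- Both sides have the same product with a₁ + a₂, whose range is dense.
  have cA : cfc (fun z => (φ z : ℂ)) x = A := by
    have h3 : cfc (fun z => (φ z : ℂ)) x * (a₁ + a₂) = A * (a₁ + a₂) := by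
      rw [hAb, ← cb, cmul φ _ hφ cadd, ← c₁, ← c₂, cmul _ _ cre cim]
      refine cfc_congr fun z hz => ?_
      have : φ z * (z.re + z.im) = z.re * z.im := by
        by_cases h : z.re + z.im = 0
        · have : z.re = 0 := by linarith [q₁ z hz, q₂ z hz]
          rw [h, this]; simp
        · exact div_mul_cancel₀ _ h
      simp only [this]
    refine ContinuousLinearMap.ext fun y => congrFun (hd.equalizer
      (ContinuousLinearMap.continuous _) (ContinuousLinearMap.continuous _) (funext fun v => ?_)) y
    exact congrArg (fun T : E →L[ℂ] E => T v) h3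
  have cp : ∀ {ψ : ℂ → ℝ}, ContinuousOn ψ (spectrum ℂ x) →
      ContinuousOn (fun z => ψ z ^ p) (spectrum ℂ x) := fun hψ =>
    hψ.rpow_const fun _ _ => Or.inr hp0.le
  have cp₁ : ContinuousOn (fun z : ℂ => z.re ^ p * z.im) (spectrum ℂ x) := (cp cre).mul cim
  have cp₂ : ContinuousOn (fun z : ℂ => z.re * z.im ^ p) (spectrum ℂ x) := cre.mul (cp cim)
  have e1 : a₁ ^ p = cfc (fun z : ℂ => ((z.re ^ p : ℝ) : ℂ)) x := by
    rw [← c₁]; exact rpow_cfc cre hp0 (by rwa [c₁])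
  have e2 : a₂ ^ p = cfc (fun z : ℂ => ((z.im ^ p : ℝ) : ℂ)) x := by
    rw [← c₂]; exact rpow_cfc cim hp0 (by rwa [c₂])
  have e3 : A ^ p = cfc (fun z : ℂ => ((φ z ^ p : ℝ) : ℂ)) x := by
    rw [← cA]; exact rpow_cfc hφ hp0 (by rwa [cA])
  have f1 : a₁ ^ p * a₂ = cfc (fun z : ℂ => ((z.re ^ p * z.im : ℝ) : ℂ)) x := by
    rw [e1, ← c₂, cmul _ _ (cp cre) cim]
  have f2 : a₁ * a₂ ^ p = cfc (fun z : ℂ => ((z.re * z.im ^ p : ℝ) : ℂ)) x := by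
    rw [e2, ← c₁, cmul _ _ cre (cp cim)]
  have f3 : A ^ p * (a₁ + a₂) = cfc (fun z : ℂ => ((φ z ^ p * (z.re + z.im) : ℝ) : ℂ)) x := by
    rw [e3, ← cb, cmul _ _ (cp hφ) cadd]
  have f4 : a₁ ^ p * a₂ + a₁ * a₂ ^ p =
      cfc (fun z : ℂ => ((z.re ^ p * z.im + z.re * z.im ^ p : ℝ) : ℂ)) x := by
    rw [f1, f2, ← cfc_add x _ _ (hc _ cp₁) (hc _ cp₂)]
    simp
  have main := norm_cfc_apply_le (x := x) (f := fun z => φ z ^ p * (z.re + z.im))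
    (h := fun z => z.re ^ p * z.im + z.re * z.im ^ p) ((cp hφ).mul cadd)
    (cp₁.add cp₂)
    (fun z hz => mul_nonneg (Real.rpow_nonneg (hφ0 z hz) _) (add_nonneg (q₁ z hz) (q₂ z hz)))
    (fun z hz => rpow_mul_add_le (q₁ z hz) (q₂ z hz) hp0 hp1) g
  rw [← f3, ← f4] at main
  exact main.trans (norm_add_le _ _)

end CommutingPowers

/-! ### Amplifications as star homomorphisms -/

section Amplification

variable {E : Type*} [NormedAddCommGroup E] [InnerProductSpace ℂ E] [CompleteSpace E]
variable {F : Type*} [NormedAddCommGroup F] [InnerProductSpace ℂ F] [CompleteSpace F]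

variable (E F) in
/-- The amplification `A ↦ A ⊗ 1`. -/
noncomputable def leftAmplification :
    (E →L[ℂ] E) →⋆ₐ[ℂ] (HilbertTensor E F →L[ℂ] HilbertTensor E F) where
  toFun A := tensorMap A 1
  map_one' := tensorMap_one
  map_mul' A B := by rw [← tensorMap_mul, one_mul]
  map_zero' := by rw [← zero_smul ℂ (0 : E →L[ℂ] E), tensorMap_smul_left, zero_smul]
  map_add' A B := tensorMap_add_left A B 1
  commutes' c := by
    rw [Algebra.algebraMap_eq_smul_one, tensorMap_smul_left, tensorMap_one,
      Algebra.algebraMap_eq_smul_one]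
  map_star' A := by rw [star_tensorMap, star_one]

variable (E F) in
/-- The amplification `B ↦ 1 ⊗ B`. -/
noncomputable def rightAmplification :
    (F →L[ℂ] F) →⋆ₐ[ℂ] (HilbertTensor E F →L[ℂ] HilbertTensor E F) where
  toFun B := tensorMap 1 B
  map_one' := tensorMap_one
  map_mul' A B := by rw [← tensorMap_mul, one_mul]
  map_zero' := by rw [← zero_smul ℂ (0 : F →L[ℂ] F), tensorMap_smul_right, zero_smul]
  map_add' A B := tensorMap_add_right 1 A B
  commutes' c := by
    rw [Algebra.algebraMap_eq_smul_one, tensorMap_smul_right, tensorMap_one,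
      Algebra.algebraMap_eq_smul_one]
  map_star' A := by rw [star_tensorMap, star_one]

theorem continuous_leftAmplification : Continuous (leftAmplification E F) :=
  AddMonoidHomClass.continuous_of_bound (leftAmplification E F) 1 fun A => by
    rw [one_mul]
    exact (norm_tensorMap_le _ _).trans
      (mul_le_of_le_one_right (norm_nonneg _) ContinuousLinearMap.norm_id_le)

theorem continuous_rightAmplification : Continuous (rightAmplification E F) :=
  AddMonoidHomClass.continuous_of_bound (rightAmplification E F) 1 fun A => by
    rw [one_mul]
    exact (norm_tensorMap_le _ _).trans
      (mul_le_of_le_one_left (norm_nonneg _) ContinuousLinearMap.norm_id_le)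

theorem starAlgHom_nonneg (φ : (E →L[ℂ] E) →⋆ₐ[ℂ] (F →L[ℂ] F)) {A : E →L[ℂ] E} (hA : 0 ≤ A) :
    0 ≤ φ A := by
  obtain ⟨S, rfl⟩ := CStarAlgebra.nonneg_iff_eq_star_mul_self.1 hA
  rw [map_mul, map_star]
  exact star_mul_self_nonneg (φ S)

/-- Continuous star homomorphisms commute with the functional calculus; for the amplifications this
identifies (A ⊗ 1)^p with A^p ⊗ 1. -/
theorem starAlgHom_rpow {φ : (E →L[ℂ] E) →⋆ₐ[ℂ] (F →L[ℂ] F)} (hφ : Continuous φ)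
    {A : E →L[ℂ] E} (hA : 0 ≤ A) {p : ℝ} (hp : 0 < p) : φ A ^ p = φ (A ^ p) :=
  (StarAlgHom.map_cfc (R := NNReal) φ (fun x => x ^ p) A
    (NNReal.continuous_rpow_const hp.le).continuousOn hφ hA (starAlgHom_nonneg φ hA)).symm

end Amplification

/-! ### Exchange of the two factors -/

section Swap

variable {E : Type*} [NormedAddCommGroup E] [InnerProductSpace ℂ E]
variable {F : Type*} [NormedAddCommGroup F] [InnerProductSpace ℂ F]

variable (E F) in
/-- The exchange of the factors of a Hilbert tensor product. -/
noncomputable def tensorSwap : HilbertTensor E F →L[ℂ] HilbertTensor F E :=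
  (TensorProduct.commIsometry ℂ E F).toLinearIsometry.toContinuousLinearMap.completion

theorem tensorSwap_coe (w : E ⊗[ℂ] F) : tensorSwap E F (toHilbertTensor E F w) =
    toHilbertTensor F E (TensorProduct.comm ℂ E F w) :=
  UniformSpace.Completion.map_coe (ContinuousLinearMap.uniformContinuous _) w

theorem norm_tensorSwap (g : HilbertTensor E F) : ‖tensorSwap E F g‖ = ‖g‖ := by
  refine tensor_ext_apply (tensorSwap E F).continuous.norm continuous_norm (fun w => ?_) g
  rw [tensorSwap_coe, LinearIsometry.norm_map, LinearIsometry.norm_map, TensorProduct.norm_comm]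

theorem tensorMap_tensorSwap (A : F →L[ℂ] F) (B : E →L[ℂ] E) (g : HilbertTensor E F) :
    tensorMap A B (tensorSwap E F g) = tensorSwap E F (tensorMap B A g) := by
  rw [← ContinuousLinearMap.comp_apply, ← ContinuousLinearMap.comp_apply]
  congr 1
  exact tensor_ext fun x y => by
    simp only [ContinuousLinearMap.comp_apply, tensorSwap_coe, tensorMap_apply_tmul,
      TensorProduct.comm_tmul]

end Swap

/-! ### Cuspidality in terms of bounded operators -/

section Bounded

variable {H : Type*} [NormedAddCommGroup H] [InnerProductSpace ℂ H] [CompleteSpace H]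

theorem IsSelfAdjointGeOne.rpow_mul_rpow {L : H →ₗ.[ℂ] H} (hL : IsSelfAdjointGeOne L) {s t : ℝ}
    (hs : 0 < s) (ht : 0 ≤ t) :
    boundedInverse L ^ s * boundedInverse L ^ t = boundedInverse L ^ (s + t) := by
  rcases ht.eq_or_lt with rfl | ht
  · rw [CFC.rpow_zero _ (boundedInverse_nonneg hL), mul_one, add_zero]
  · have hs' : (0 : NNReal) < ⟨s, hs.le⟩ := hs
    have ht' : (0 : NNReal) < ⟨t, ht.le⟩ := ht
    have h := CFC.nnrpow_add (a := boundedInverse L) hs' ht'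
    rw [CFC.nnrpow_eq_rpow hs', CFC.nnrpow_eq_rpow ht', CFC.nnrpow_eq_rpow (add_pos hs' ht')] at h
    exact h.symm

theorem IsSelfAdjointGeOne.rpow_mul_rpow_one_sub {L : H →ₗ.[ℂ] H} (hL : IsSelfAdjointGeOne L)
    {s : ℝ} (hs : 0 < s) (h1 : s ≤ 1) :
    boundedInverse L ^ s * boundedInverse L ^ (1 - s) = boundedInverse L := by
  rw [hL.rpow_mul_rpow hs (by linarith), add_sub_cancel, CFC.rpow_one _ (boundedInverse_nonneg hL)]

theorem IsSelfAdjointGeOne.rpow_injective {L : H →ₗ.[ℂ] H} (hL : IsSelfAdjointGeOne L)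
    {s : ℝ} (hs : 0 < s) (h1 : s ≤ 1) : Function.Injective (boundedInverse L ^ s : H →L[ℂ] H) := by
  rw [injective_iff_map_eq_zero]
  intro x hx
  have := LinearMap.ker_eq_bot'.1 (ker_boundedInverse_rpow hL hs h1) ⟨x, trivial⟩ hx
  exact congrArg Subtype.val this

/-- Since Λ^s Λ⁻¹ = (Λ⁻¹)^(1-s), estimates of Λ^s on D(Λ) become estimates of bounded powers. -/
theorem IsSelfAdjointGeOne.rpow_apply {L : H →ₗ.[ℂ] H} (hL : IsSelfAdjointGeOne L)
    {s : ℝ} (hs : 0 < s) (h1 : s ≤ 1) {u : (CuspidalOperator.rpow L s).domain} {y : H}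
    (hu : boundedInverse L y = u) :
    CuspidalOperator.rpow L s u = (boundedInverse L ^ (1 - s)) y := by
  have hg : ((u : H), (boundedInverse L ^ (1 - s)) y) ∈ (CuspidalOperator.rpow L s).graph := by
    rw [mem_graph_rpow_iff hL hs h1, ← mul_apply_eq_comp, hL.rpow_mul_rpow_one_sub hs h1, hu]
  obtain ⟨v, hv, hv'⟩ := (LinearPMap.mem_graph_iff _).1 hg
  simp only at hv hv'
  rw [← hv']
  congr 1
  exact (Subtype.ext hv).symm

/-- The data of a cuspidal operator in terms of bounded operators: the resolvent
`G = (1/2 + K)⁻¹`, the operators `B = K Λ⁻¹` and `S = Λ ^ r G`. -/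
theorem IsCuspidal.exists_bounded {L K : H →ₗ.[ℂ] H} {r : ℝ} (h : IsCuspidal L r K) :
    ∃ (G B S : H →L[ℂ] H) (C : ℝ), 0 ≤ C ∧
      (∀ p : H × H, p ∈ K.graph ↔ ∃ g, (G g, g - (1 / 2 : ℂ) • G g) = p) ∧
      (∀ g, 1 / 2 * ‖G g‖ ^ 2 ≤ (⟪g, G g⟫_ℂ).re) ∧ Function.Injective G ∧
      (∀ y, (boundedInverse L y, B y) ∈ K.graph) ∧
      G * (B + (1 / 2 : ℂ) • boundedInverse L) = boundedInverse L ∧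
      DenseRange (B + (1 / 2 : ℂ) • boundedInverse L) ∧
      boundedInverse L ^ r * S = G ∧
      ∀ (x : H) (μ : ℝ), ‖S x‖ ≤ C * ‖x + (Complex.I * μ) • G x‖ := by
  have hL := h.selfAdjointGeOne
  have hr := h.exponent_pos
  have hr1 := h.exponent_le_one
  obtain ⟨C, hC, hKb, hsub⟩ := h.bound
  obtain ⟨G, hG, hGa, hGi, hGd⟩ := h.maximalAccretive.exists_resolvent
  have hA := isBoundedInverse_boundedInverse hL
  have hAdom : ∀ y, boundedInverse L y ∈ L.domain := fun y =>
    LinearPMap.mem_domain_of_mem_graph ((hA _ y).2 rfl)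
  have hLA : ∀ y, L ⟨boundedInverse L y, hAdom y⟩ = y := fun y => by
    obtain ⟨u, hu, hu'⟩ := L.mem_graph_iff.1 ((hA _ y).2 rfl)
    simp only at hu hu'
    calc L ⟨boundedInverse L y, hAdom y⟩ = L u := by
          congr 1
          exact (Subtype.ext hu).symm
      _ = y := hu'
  have hAL : ∀ u : L.domain, boundedInverse L (L u) = u := fun u => (hA _ _).1 (L.mem_graph u)
  let j : H →ₗ[ℂ] K.domain := LinearMap.codRestrict K.domain
    (boundedInverse L : H →ₗ[ℂ] H) fun y => h.domain_le (hAdom y)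
  let B : H →L[ℂ] H := (K.toFun ∘ₗ j).mkContinuous C fun y => by
    have := hKb ⟨_, hAdom y⟩
    rwa [hLA] at this
  have hB : ∀ y, (boundedInverse L y, B y) ∈ K.graph := fun y => K.mem_graph (j y)
  have hBu : ∀ u : L.domain, B (L u) = K ⟨u, h.domain_le u.2⟩ := fun u => by
    change K (j (L u)) = _
    congr 1
    exact Subtype.ext (hAL u)
  have hsub' : ∀ y (t : ℝ), ‖(boundedInverse L ^ (1 - r)) y‖ ≤
      C * (‖B y - (Complex.I * t) • boundedInverse L y‖ + ‖boundedInverse L y‖) := by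
    intro y t
    have := hsub ⟨_, hAdom y⟩ t
    rwa [hL.rpow_apply hr hr1 (y := y) rfl] at this
  have hGe : ∀ y, G (B y + (1 / 2 : ℂ) • boundedInverse L y) = boundedInverse L y := by
    intro y
    obtain ⟨g, hg⟩ := (hG _).1 (hB y)
    obtain ⟨hg1, hg2⟩ := Prod.ext_iff.1 hg
    simp only at hg1 hg2
    rw [← hg2, ← hg1, sub_add_cancel]
  set e : H →L[ℂ] H := B + (1 / 2 : ℂ) • boundedInverse L with he
  -- Here e = (K + 1/2) Λ⁻¹. Every x is (K + 1/2) k with k in D(K), and k is approximated from D(Λ)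
  -- in the graph norm.
  have hed : DenseRange e := by
    intro x
    rw [Metric.mem_closure_iff]
    intro ε hε
    obtain ⟨k, hk, hk'⟩ := K.mem_graph_iff.1 ((hG _).2 ⟨x, rfl⟩)
    simp only at hk hk'
    obtain ⟨u, hu⟩ := h.dense k ε hε
    refine ⟨e (L u), ⟨L u, rfl⟩, ?_⟩
    have h1 : e (L u) = K ⟨u, h.domain_le u.2⟩ + (1 / 2 : ℂ) • (u : H) := by
      rw [he, add_apply, smul_apply, hBu, hAL]
    have h2 : x = K k + (1 / 2 : ℂ) • (k : H) := by rw [hk, hk', sub_add_cancel]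
    rw [dist_comm, dist_eq_norm, h1, h2, add_sub_add_comm, ← smul_sub]
    refine (norm_add_le _ _).trans_lt ?_
    rw [norm_smul]
    norm_num
    linarith [norm_nonneg ((u : H) - k)]
  -- With a = Λ⁻¹ y and d = e y + iμ a, accretivity gives ‖a‖² / 2 ≤ Re ⟨a, d⟩, so ‖a‖ ≤ 2 ‖d‖. The
  -- hypothesis at t = -μ then bounds the left side by C (‖d - a/2‖ + ‖a‖) ≤ 4 C ‖d‖.
  have hest : ∀ y (μ : ℝ), ‖(boundedInverse L ^ (1 - r)) y‖ ≤
      4 * C * ‖e y + (Complex.I * μ) • G (e y)‖ := by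
    intro y μ
    have h1 : G (e y) = boundedInverse L y := hGe y
    rw [h1]
    set a := boundedInverse L y
    set d := e y + (Complex.I * μ) • a with hd
    have h2 : d = B y + (1 / 2 : ℂ) • a + (Complex.I * μ) • a := rfl
    have h3 : 0 ≤ (⟪a, B y⟫_ℂ).re := h.maximalAccretive.re_nonneg_of_mem_graph (hB y)
    have h4 : (⟪a, d⟫_ℂ).re = (⟪a, B y⟫_ℂ).re + 1 / 2 * ‖a‖ ^ 2 := by
      rw [h2, inner_add_right, inner_add_right, inner_smul_right, inner_smul_right,
        inner_self_eq_norm_sq_to_K]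
      have : ((‖a‖ : ℂ)) ^ 2 = ((‖a‖ ^ 2 : ℝ) : ℂ) := by push_cast; rfl
      change (⟪a, B y⟫_ℂ + 1 / 2 * (‖a‖ : ℂ) ^ 2 + Complex.I * μ * (‖a‖ : ℂ) ^ 2).re = _
      rw [this]
      simp [-Complex.ofReal_pow]
    have h5 : (⟪a, d⟫_ℂ).re ≤ ‖a‖ * ‖d‖ := re_inner_le_norm (𝕜 := ℂ) _ _
    have h6 : ‖a‖ ≤ 2 * ‖d‖ := by
      by_contra! hlt
      nlinarith [norm_nonneg a, norm_nonneg d]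
    have h7 := hsub' y (-μ)
    have h8 : B y - (Complex.I * ((-μ : ℝ) : ℂ)) • a = d - (1 / 2 : ℂ) • a := by
      rw [h2]; push_cast; module
    have h9 : ‖d - (1 / 2 : ℂ) • a‖ ≤ ‖d‖ + 1 / 2 * ‖a‖ := by
      refine (norm_sub_le _ _).trans_eq ?_
      rw [norm_smul]
      norm_num
    rw [h8] at h7
    calc _ ≤ C * (‖d‖ + 1 / 2 * ‖a‖ + ‖a‖) := h7.trans (by gcongr)
      _ ≤ C * (4 * ‖d‖) := by gcongr; linarith
      _ = _ := by ring
  let f : H →ₗ[ℂ] H := ((boundedInverse L ^ (1 - r) : H →L[ℂ] H) : H →ₗ[ℂ] H)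
  have hfe : ∀ y, ‖f y‖ ≤ 4 * C * ‖(e : H →ₗ[ℂ] H) y‖ := fun y => by
    have := hest y 0
    rw [Complex.ofReal_zero, mul_zero, zero_smul, add_zero] at this
    exact this
  -- S = Λ^r G is prescribed on the dense range of e by e y ↦ (Λ⁻¹)^(1-r) y and extended using the
  -- estimate at μ = 0.
  let S : H →L[ℂ] H := f.extendOfNorm (e : H →ₗ[ℂ] H)
  have hS : ∀ y, S (e y) = (boundedInverse L ^ (1 - r)) y := fun y =>
    LinearMap.extendOfNorm_eq (f := f) (e := (e : H →ₗ[ℂ] H)) hed ⟨4 * C, hfe⟩ y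
  refine ⟨G, B, S, 4 * C, by positivity, hG, hGa, hGi, hB, ContinuousLinearMap.ext hGe, hed, ?_,
    fun x μ => ?_⟩
  · refine ContinuousLinearMap.ext fun y => congrFun (hed.equalizer
      (ContinuousLinearMap.continuous _) (ContinuousLinearMap.continuous _) (funext fun v => ?_)) y
    simp only [Function.comp_apply]
    rw [mul_apply_eq_comp, hS, ← mul_apply_eq_comp, hL.rpow_mul_rpow_one_sub hr hr1]
    exact (hGe v).symm
  · refine hed.induction_on x (isClosed_le (by fun_prop) (by fun_prop)) fun y => ?_
    rw [hS]
    exact hest y μ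

end Bounded

/-! ### Assembling cuspidality from estimates in each factor -/

section Commuting

variable {T : Type*} [NormedAddCommGroup T] [InnerProductSpace ℂ T] [CompleteSpace T]
variable {E : Type*} [NormedAddCommGroup E] [InnerProductSpace ℂ E] [CompleteSpace E]
variable {F : Type*} [NormedAddCommGroup F] [InnerProductSpace ℂ F] [CompleteSpace F]

/-- Cuspidality of `K` with respect to `L`, when `L⁻¹` is the parallel sum of commuting operators
`φ₁ A₁` and `φ₂ A₂`, from estimates for the powers of `A₁` and of `A₂`. -/
theorem isCuspidal_of_commuting {L K : T →ₗ.[ℂ] T} (hL : IsSelfAdjointGeOne L)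
    (hK : IsMaximalAccretive K) {r : ℝ} (hr0 : 0 < r) (hr1 : r < 1) {Z : T →L[ℂ] T}
    (hZ : ∀ y, (boundedInverse L y, Z y) ∈ K.graph)
    (hcore : ∀ p ∈ K.graph, p ∈ closure (Set.range fun y => (boundedInverse L y, Z y)))
    {φ₁ : (E →L[ℂ] E) →⋆ₐ[ℂ] (T →L[ℂ] T)} {φ₂ : (F →L[ℂ] F) →⋆ₐ[ℂ] (T →L[ℂ] T)}
    (hφ₁ : Continuous φ₁) (hφ₂ : Continuous φ₂) {A₁ : E →L[ℂ] E} {A₂ : F →L[ℂ] F}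
    (hA₁ : 0 ≤ A₁) (hA₂ : 0 ≤ A₂) (hcomm : φ₁ A₁ * φ₂ A₂ = φ₂ A₂ * φ₁ A₁)
    (hAb : boundedInverse L * (φ₁ A₁ + φ₂ A₂) = φ₁ A₁ * φ₂ A₂)
    (hd : DenseRange (φ₁ A₁ + φ₂ A₂)) {C : ℝ} (hC : 0 ≤ C)
    (hest₁ : ∀ g (t : ℝ), ‖φ₁ (A₁ ^ (1 - r)) (φ₂ A₂ g)‖ ≤
      C * (‖Z ((φ₁ A₁ + φ₂ A₂) g) -
        (Complex.I * t) • boundedInverse L ((φ₁ A₁ + φ₂ A₂) g)‖ +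
        ‖boundedInverse L ((φ₁ A₁ + φ₂ A₂) g)‖))
    (hest₂ : ∀ g (t : ℝ), ‖φ₁ A₁ (φ₂ (A₂ ^ (1 - r)) g)‖ ≤
      C * (‖Z ((φ₁ A₁ + φ₂ A₂) g) -
        (Complex.I * t) • boundedInverse L ((φ₁ A₁ + φ₂ A₂) g)‖ +
        ‖boundedInverse L ((φ₁ A₁ + φ₂ A₂) g)‖)) :
    IsCuspidal L r K := by
  have hA := isBoundedInverse_boundedInverse hL
  have hAL : ∀ u : L.domain, boundedInverse L (L u) = u := fun u => (hA _ _).1 (L.mem_graph u)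
  have hdom : ∀ u : L.domain, ∃ k : K.domain, (k : T) = u ∧ K k = Z (L u) := fun u => by
    obtain ⟨k, hk, hk'⟩ := K.mem_graph_iff.1 (hZ (L u))
    exact ⟨k, hk.trans (hAL u), hk'⟩
  have hle : L.domain ≤ K.domain := fun u hu => by
    obtain ⟨k, hk, -⟩ := hdom ⟨u, hu⟩
    rw [← show (k : T) = u from hk]
    exact k.2
  have hKu : ∀ u : L.domain, K ⟨u, hle u.2⟩ = Z (L u) := fun u => by
    obtain ⟨k, hk, hk'⟩ := hdom u
    rw [← hk']
    congr 1
    exact (Subtype.ext hk).symm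
  have hest : ∀ (t : ℝ) y, ‖(boundedInverse L ^ (1 - r)) y‖ ≤
      2 * C * (‖Z y - (Complex.I * t) • boundedInverse L y‖ + ‖boundedInverse L y‖) := by
    intro t y
    refine hd.induction_on y (isClosed_le (by fun_prop) (by fun_prop)) fun g => ?_
    have h := norm_rpow_apply_le (starAlgHom_nonneg φ₁ hA₁) (starAlgHom_nonneg φ₂ hA₂)
      (boundedInverse_nonneg hL) hcomm hAb hd (p := 1 - r) (by linarith) (by linarith) g
    rw [starAlgHom_rpow hφ₁ hA₁ (by linarith), starAlgHom_rpow hφ₂ hA₂ (by linarith)] at h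
    linarith [hest₁ g t, hest₂ g t]
  refine ⟨hL, hr0, hr1.le, hK, hle, fun x ε hε => ?_, ‖Z‖ + 2 * C + 1, by positivity,
    fun u => ?_, fun u t => ?_⟩
  · obtain ⟨_, ⟨y, rfl⟩, hy⟩ :=
      Metric.mem_closure_iff.1 (hcore _ (K.mem_graph x)) (ε / 2) (by linarith)
    obtain ⟨u, hu, hu'⟩ := L.mem_graph_iff.1 ((hA _ y).2 rfl)
    simp only at hu hu'
    refine ⟨u, ?_⟩
    rw [hKu, hu', hu]
    rw [dist_comm, Prod.dist_eq, max_lt_iff, dist_eq_norm, dist_eq_norm] at hy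
    linarith [hy.1, hy.2]
  · rw [hKu]
    refine (Z.le_opNorm _).trans ?_
    gcongr
    linarith
  · rw [hKu, hL.rpow_apply hr0 hr1.le (y := L u) (hAL u)]
    have h := hest t (L u)
    rw [hAL] at h
    refine h.trans ?_
    gcongr
    linarith [norm_nonneg Z]

end Commuting

/-! ### The subelliptic estimate in one factor -/

section Estimate

variable {H₁ : Type*} [NormedAddCommGroup H₁] [InnerProductSpace ℂ H₁] [CompleteSpace H₁]
variable {H₂ : Type*} [NormedAddCommGroup H₂] [InnerProductSpace ℂ H₂] [CompleteSpace H₂]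

/-- The estimate of `(Λ₁ ^ s ⊗ 1) u` by `(K - i t) u` and `u`, where
`u = (Λ₁⁻¹ ⊗ Λ₂⁻¹) h`. -/
theorem IsCuspidal.exists_norm_tensorMap_rpow_le {L₁ K₁ : H₁ →ₗ.[ℂ] H₁} {L₂ K₂ : H₂ →ₗ.[ℂ] H₂}
    {r₁ r₂ : ℝ} (h₁ : IsCuspidal L₁ r₁ K₁) (h₂ : IsCuspidal L₂ r₂ K₂) {s : ℝ} (hs0 : 0 < s)
    (hs1 : s < r₁) {B₁ : H₁ →L[ℂ] H₁} {B₂ : H₂ →L[ℂ] H₂}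
    (hB₁ : ∀ y, (boundedInverse L₁ y, B₁ y) ∈ K₁.graph)
    (hB₂ : ∀ y, (boundedInverse L₂ y, B₂ y) ∈ K₂.graph) :
    ∃ C : ℝ, 0 ≤ C ∧ ∀ (h : HilbertTensor H₁ H₂) (t : ℝ),
      ‖tensorMap (boundedInverse L₁ ^ (1 - s)) (boundedInverse L₂) h‖ ≤
        C * (‖(tensorMap B₁ (boundedInverse L₂) + tensorMap (boundedInverse L₁) B₂) h -
          (Complex.I * t) • tensorMap (boundedInverse L₁) (boundedInverse L₂) h‖ +
          ‖tensorMap (boundedInverse L₁) (boundedInverse L₂) h‖) := by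
  obtain ⟨G₁, B₁', S₁, C₁, hC₁, -, hGa₁, hGi₁, hBg₁, hGe₁, -, hS₁, hest₁⟩ := h₁.exists_bounded
  obtain ⟨G₂, B₂', S₂, C₂, -, -, hGa₂, hGi₂, hBg₂, hGe₂, -, -, -⟩ := h₂.exists_bounded
  obtain rfl : B₁ = B₁' := ContinuousLinearMap.ext fun y =>
    LinearPMap.mem_graph_snd_inj K₁ (hB₁ y) (hBg₁ y) rfl
  obtain rfl : B₂ = B₂' := ContinuousLinearMap.ext fun y =>
    LinearPMap.mem_graph_snd_inj K₂ (hB₂ y) (hBg₂ y) rfl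
  have hL₁ := h₁.selfAdjointGeOne
  have hr1 := h₁.exponent_le_one
  -- This is Λ₁^s Λ₁⁻¹ = Λ₁^(s-r₁) · Λ₁^r₁ G₁ · (K₁ + 1/2) Λ₁⁻¹, verified after applying the
  -- injective Λ₁^(-s).
  have hpow : boundedInverse L₁ ^ (1 - s) = (boundedInverse L₁ ^ (r₁ - s)) *
      (S₁ * (B₁ + (1 / 2 : ℂ) • boundedInverse L₁)) := by
    refine ContinuousLinearMap.ext fun x => hL₁.rpow_injective hs0 (by linarith) ?_
    rw [← mul_apply_eq_comp, ← mul_apply_eq_comp, hL₁.rpow_mul_rpow_one_sub hs0 (by linarith),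
      ← mul_assoc, hL₁.rpow_mul_rpow hs0 (by linarith), add_sub_cancel, ← mul_assoc, hS₁, hGe₁]
  generalize boundedInverse L₁ ^ (1 - s) = P at hpow ⊢
  generalize boundedInverse L₁ ^ (r₁ - s) = D at hpow
  generalize boundedInverse L₁ = A₁ at *
  generalize boundedInverse L₂ = A₂ at *
  refine ⟨‖tensorMap D (1 : H₂ →L[ℂ] H₂)‖ * C₁, by positivity, fun h t => ?_⟩
  set e₁ := B₁ + (1 / 2 : ℂ) • A₁ with he₁
  set e₂ := B₂ + (1 / 2 : ℂ) • A₂ with he₂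
  set g := tensorMap e₁ e₂ h with hg
  -- X G₂⁻¹ is K₂ - it on D(K₂), so for u = (G₁ ⊗ G₂) g the vector (1 ⊗ G₂ + G₁ ⊗ X) g is (K + 1/2 -
  -- it) u; the single 1/2 comes from G₁.
  let X : H₂ →L[ℂ] H₂ := 1 - (1 / 2 + Complex.I * t) • G₂
  have hX : ∀ y, 0 ≤ (⟪G₂ y, X y⟫_ℂ).re := by
    intro y
    have h1 := hGa₂ y
    have h2 := inner_re_symm (𝕜 := ℂ) y (G₂ y)
    have h3 := inner_self_eq_norm_sq_to_K (𝕜 := ℂ) (G₂ y)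
    simp only [RCLike.re_to_complex] at h2
    have h4 : ((‖G₂ y‖ : ℂ)) ^ 2 = ((‖G₂ y‖ ^ 2 : ℝ) : ℂ) := by push_cast; rfl
    have h5 : ((1 / 2 + Complex.I * t) * ((‖G₂ y‖ ^ 2 : ℝ) : ℂ)).re = 1 / 2 * ‖G₂ y‖ ^ 2 := by
      simp [-Complex.ofReal_pow]
    change 0 ≤ (⟪G₂ y, y - (1 / 2 + Complex.I * t) • G₂ y⟫_ℂ).re
    rw [inner_sub_right, inner_smul_right, Complex.sub_re, h3]
    change 0 ≤ _ - ((1 / 2 + Complex.I * t) * (‖G₂ y‖ : ℂ) ^ 2).re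
    rw [h4, h5]
    linarith
  have key := norm_tensorMap_le_of_re_inner_nonneg hC₁ hest₁ (by norm_num) hGa₁ hGi₁ hGi₂ hX g
  have hP : tensorMap P A₂ h = tensorMap D 1 (tensorMap S₁ G₂ g) := by
    rw [hg, ← mul_apply_eq_comp (tensorMap S₁ G₂), ← tensorMap_mul, hGe₂,
      ← mul_apply_eq_comp (tensorMap D 1), ← tensorMap_mul, one_mul, hpow]
  have hXe : X * e₂ = B₂ - (Complex.I * t) • A₂ := by
    rw [sub_mul, one_mul, smul_mul_assoc, hGe₂, he₂]
    module
  have hR : tensorMap (1 : H₁ →L[ℂ] H₁) G₂ g + tensorMap G₁ X g =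
      ((tensorMap B₁ A₂ + tensorMap A₁ B₂) h - (Complex.I * t) • tensorMap A₁ A₂ h) +
        (1 / 2 : ℂ) • tensorMap A₁ A₂ h := by
    rw [hg, ← mul_apply_eq_comp, ← mul_apply_eq_comp, ← tensorMap_mul, ← tensorMap_mul, hGe₁, hGe₂,
      one_mul, hXe, he₁, tensorMap_add_left, tensorMap_smul_left, tensorMap_sub_right,
      tensorMap_smul_right]
    simp only [add_apply, sub_apply, smul_apply]
    module
  rw [hR] at key
  rw [hP, mul_assoc]
  refine (ContinuousLinearMap.le_opNorm _ _).trans ?_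
  gcongr
  refine key.trans ?_
  gcongr
  refine (norm_add_le _ _).trans ?_
  gcongr
  rw [norm_smul]
  norm_num
  linarith [norm_nonneg (tensorMap A₁ A₂ h)]

end Estimate

/-! ### The inverse of Λ, the core property and the conclusion -/

section TensorSumInverse

variable {H₁ : Type*} [NormedAddCommGroup H₁] [InnerProductSpace ℂ H₁] [CompleteSpace H₁]
variable {H₂ : Type*} [NormedAddCommGroup H₂] [InnerProductSpace ℂ H₂] [CompleteSpace H₂]
variable {L₁ : H₁ →ₗ.[ℂ] H₁} {L₂ : H₂ →ₗ.[ℂ] H₂}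

/-- The operator `A₁ ⊗ 1 + 1 ⊗ A₂` for bounded `A₁` and `A₂`. -/
noncomputable abbrev boundedTensorSum (A₁ : H₁ →L[ℂ] H₁) (A₂ : H₂ →L[ℂ] H₂) :
    HilbertTensor H₁ H₂ →L[ℂ] HilbertTensor H₁ H₂ :=
  tensorMap A₁ 1 + tensorMap 1 A₂

/-- `Λ⁻¹ (Λ₁⁻¹ ⊗ 1 + 1 ⊗ Λ₂⁻¹) = Λ₁⁻¹ ⊗ Λ₂⁻¹`. -/
theorem boundedInverse_tensorSum_mul (h₁ : IsSelfAdjointGeOne L₁) (h₂ : IsSelfAdjointGeOne L₂) :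
    boundedInverse (tensorSum L₁ L₂) *
      (boundedTensorSum (boundedInverse L₁) (boundedInverse L₂)) =
        tensorMap (boundedInverse L₁) (boundedInverse L₂) := by
  have hA := isBoundedInverse_boundedInverse (isSelfAdjointGeOne_tensorSum h₁ h₂)
  refine ContinuousLinearMap.ext fun g => tensor_ext_apply (ContinuousLinearMap.continuous _)
    (ContinuousLinearMap.continuous _) (fun w => ?_) g
  have h := (hA _ _).1 (mem_graph_closure (mem_graph_algTensorSum_of_selfAdjoint h₁ h₂ w))
  rw [← h, add_comm]
  rfl

theorem denseRange_tensorMap_boundedInverse_add (h₁ : IsSelfAdjointGeOne L₁)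
    (h₂ : IsSelfAdjointGeOne L₂) :
    DenseRange (boundedTensorSum (boundedInverse L₁) (boundedInverse L₂)) :=
  denseRange_tensorMap_add zero_lt_one (le_re_inner_boundedInverse' h₁)
    (boundedInverse_injective h₁) (re_inner_nonneg_of_nonneg (boundedInverse_nonneg h₂))

theorem re_inner_tensorMap_one_tensorMap_one_nonneg {A₁ : H₁ →L[ℂ] H₁} {A₂ : H₂ →L[ℂ] H₂}
    (h₁ : 0 ≤ A₁) (h₂ : 0 ≤ A₂) (g : HilbertTensor H₁ H₂) :
    0 ≤ (⟪tensorMap A₁ 1 g, tensorMap 1 A₂ g⟫_ℂ).re := by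
  have hs : (tensorMap A₁ (1 : H₂ →L[ℂ] H₂)).adjoint = tensorMap A₁ 1 := by
    rw [← ContinuousLinearMap.star_eq_adjoint, star_tensorMap, star_one,
      (IsSelfAdjoint.of_nonneg h₁).star_eq]
  rw [← hs, ContinuousLinearMap.adjoint_inner_left, ← mul_apply_eq_comp, ← tensorMap_mul, one_mul,
    mul_one]
  exact re_inner_nonneg_of_nonneg (tensorMap_nonneg h₁ h₂) g

/-- Produces Z = K Λ⁻¹ as a bounded operator. The vectors (A₁ ⊗ 1) h and (1 ⊗ A₂) h have an inner
product with nonnegative real part, so each is dominated in norm by their sum; for A_j = Λ_j⁻¹ this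
expresses ‖Λ_j u‖ ≤ ‖Λ u‖. -/
theorem exists_extension_tensorMap_add {A₁ B₁ : H₁ →L[ℂ] H₁} {A₂ B₂ : H₂ →L[ℂ] H₂} (h₁ : 0 ≤ A₁)
    (h₂ : 0 ≤ A₂) (hd : DenseRange (boundedTensorSum A₁ A₂)) :
    ∃ Z : HilbertTensor H₁ H₂ →L[ℂ] HilbertTensor H₁ H₂,
      ∀ h, Z (boundedTensorSum A₁ A₂ h) = (tensorMap B₁ A₂ + tensorMap A₁ B₂) h := by
  let f : HilbertTensor H₁ H₂ →ₗ[ℂ] HilbertTensor H₁ H₂ :=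
    (tensorMap B₁ A₂ + tensorMap A₁ B₂ : HilbertTensor H₁ H₂ →L[ℂ] HilbertTensor H₁ H₂)
  let e : HilbertTensor H₁ H₂ →ₗ[ℂ] HilbertTensor H₁ H₂ :=
    boundedTensorSum A₁ A₂
  refine ⟨f.extendOfNorm e, fun h => LinearMap.extendOfNorm_eq (f := f) (e := e) hd
    ⟨‖tensorMap B₁ (1 : H₂ →L[ℂ] H₂)‖ + ‖tensorMap (1 : H₁ →L[ℂ] H₁) B₂‖, fun h => ?_⟩ h⟩
  have hn := re_inner_tensorMap_one_tensorMap_one_nonneg h₁ h₂ h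
  have hle₁ := norm_le_norm_add_of_re_inner_nonneg hn
  have hn' := inner_re_symm (𝕜 := ℂ) (tensorMap A₁ 1 h) (tensorMap 1 A₂ h)
  simp only [RCLike.re_to_complex] at hn'
  rw [hn'] at hn
  have hle₂ := norm_le_norm_add_of_re_inner_nonneg hn
  rw [add_comm] at hle₂
  have e₁ : tensorMap B₁ A₂ h = tensorMap B₁ 1 (tensorMap 1 A₂ h) := by
    rw [← mul_apply_eq_comp, ← tensorMap_mul, mul_one, one_mul]
  have e₂ : tensorMap A₁ B₂ h = tensorMap 1 B₂ (tensorMap A₁ 1 h) := by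
    rw [← mul_apply_eq_comp, ← tensorMap_mul, mul_one, one_mul]
  change ‖tensorMap B₁ A₂ h + tensorMap A₁ B₂ h‖ ≤ _ * ‖tensorMap A₁ 1 h + tensorMap 1 A₂ h‖
  rw [e₁, e₂, add_mul]
  refine (norm_add_le _ _).trans (add_le_add ?_ ?_)
  · exact (ContinuousLinearMap.le_opNorm _ _).trans (by gcongr)
  · exact (ContinuousLinearMap.le_opNorm _ _).trans (by gcongr)

/-- The vectors `(Λ⁻¹ y, K Λ⁻¹ y)` belong to the graph of `K`. -/
theorem mem_graph_tensorSum {K₁ : H₁ →ₗ.[ℂ] H₁} {K₂ : H₂ →ₗ.[ℂ] H₂}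
    (h₁ : IsSelfAdjointGeOne L₁) (h₂ : IsSelfAdjointGeOne L₂)
    (hcl : (algTensorSum K₁ K₂).IsClosable)
    {B₁ : H₁ →L[ℂ] H₁} {B₂ : H₂ →L[ℂ] H₂} (hB₁ : ∀ y, (boundedInverse L₁ y, B₁ y) ∈ K₁.graph)
    (hB₂ : ∀ y, (boundedInverse L₂ y, B₂ y) ∈ K₂.graph)
    {Z : HilbertTensor H₁ H₂ →L[ℂ] HilbertTensor H₁ H₂}
    (hZ : ∀ h, Z (boundedTensorSum (boundedInverse L₁) (boundedInverse L₂) h) =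
      (tensorMap B₁ (boundedInverse L₂) + tensorMap (boundedInverse L₁) B₂) h)
    (y : HilbertTensor H₁ H₂) :
    (boundedInverse (tensorSum L₁ L₂) y, Z y) ∈ (tensorSum K₁ K₂).graph := by
  have hc : IsClosed {y | (boundedInverse (tensorSum L₁ L₂) y, Z y) ∈ (tensorSum K₁ K₂).graph} :=
    hcl.closure_isClosed.preimage
      ((ContinuousLinearMap.continuous _).prodMk (ContinuousLinearMap.continuous _))
  refine (denseRange_tensorMap_boundedInverse_add h₁ h₂).induction_on y hc fun g => ?_
  refine denseRange_toHilbertTensor.induction_on g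
    (hc.preimage (ContinuousLinearMap.continuous _)) fun w => ?_
  rw [hZ, ← mul_apply_eq_comp, boundedInverse_tensorSum_mul h₁ h₂]
  exact mem_graph_closure (mem_graph_algTensorSum hB₁ hB₂ w)

/-- The vectors `(Λ⁻¹ y, K Λ⁻¹ y)` are dense in the graph of `K`. -/
theorem mem_closure_of_mem_graph_tensorSum {K₁ : H₁ →ₗ.[ℂ] H₁} {K₂ : H₂ →ₗ.[ℂ] H₂} {r₁ r₂ : ℝ}
    (h₁ : IsCuspidal L₁ r₁ K₁) (h₂ : IsCuspidal L₂ r₂ K₂)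
    {B₁ : H₁ →L[ℂ] H₁} {B₂ : H₂ →L[ℂ] H₂} (hB₁ : ∀ y, (boundedInverse L₁ y, B₁ y) ∈ K₁.graph)
    (hB₂ : ∀ y, (boundedInverse L₂ y, B₂ y) ∈ K₂.graph)
    {Z : HilbertTensor H₁ H₂ →L[ℂ] HilbertTensor H₁ H₂}
    (hZ : ∀ h, Z (boundedTensorSum (boundedInverse L₁) (boundedInverse L₂) h) =
      (tensorMap B₁ (boundedInverse L₂) + tensorMap (boundedInverse L₁) B₂) h)
    {p : HilbertTensor H₁ H₂ × HilbertTensor H₁ H₂} (hp : p ∈ (tensorSum K₁ K₂).graph) :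
    p ∈ closure (Set.range fun y => (boundedInverse (tensorSum L₁ L₂) y, Z y)) := by
  have hcl := isClosable_algTensorSum h₁.maximalAccretive h₂.maximalAccretive
  have hb := boundedInverse_tensorSum_mul h₁.selfAdjointGeOne h₂.selfAdjointGeOne
  refine closure_graph_induction hcl isClosed_closure (fun p hp => ?_) hp
  obtain ⟨G₁, B₁', -, -, -, hG₁, -, -, hBg₁, hGe₁, hed₁, -, -⟩ := h₁.exists_bounded
  obtain ⟨G₂, B₂', -, -, -, hG₂, -, -, hBg₂, hGe₂, hed₂, -, -⟩ := h₂.exists_bounded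
  obtain rfl : B₁ = B₁' := ContinuousLinearMap.ext fun y =>
    LinearPMap.mem_graph_snd_inj K₁ (hB₁ y) (hBg₁ y) rfl
  obtain rfl : B₂ = B₂' := ContinuousLinearMap.ext fun y =>
    LinearPMap.mem_graph_snd_inj K₂ (hB₂ y) (hBg₂ y) rfl
  obtain ⟨w, rfl⟩ := exists_of_mem_graph_algTensorSum
    (P₁ := G₁) (Q₁ := 1 - (1 / 2 : ℂ) • G₁) (P₂ := G₂) (Q₂ := 1 - (1 / 2 : ℂ) • G₂)
    (fun p hp => (hG₁ p).1 hp) (fun p hp => (hG₂ p).1 hp) hp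
  generalize toHilbertTensor H₁ H₂ w = z
  -- For z = (e₁ ⊗ e₂) h with e_j = (K_j + 1/2) Λ_j⁻¹, the vector (G₁ ⊗ G₂) z = (Λ₁⁻¹ ⊗ Λ₂⁻¹) h lies
  -- in D(Λ), and such z are dense.
  refine (denseRange_tensorMap hed₁ hed₂).induction_on z (isClosed_closure.preimage
    ((ContinuousLinearMap.continuous _).prodMk (ContinuousLinearMap.continuous _))) fun h => ?_
  refine subset_closure
    ⟨boundedTensorSum (boundedInverse L₁) (boundedInverse L₂) h, ?_⟩
  simp only
  have hQ₁ : (1 - (1 / 2 : ℂ) • G₁) * (B₁ + (1 / 2 : ℂ) • boundedInverse L₁) = B₁ := by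
    rw [sub_mul, one_mul, smul_mul_assoc, hGe₁, add_sub_cancel_right]
  have hQ₂ : (1 - (1 / 2 : ℂ) • G₂) * (B₂ + (1 / 2 : ℂ) • boundedInverse L₂) = B₂ := by
    rw [sub_mul, one_mul, smul_mul_assoc, hGe₂, add_sub_cancel_right]
  rw [hZ, ← mul_apply_eq_comp, hb, ← mul_apply_eq_comp, ← tensorMap_mul, ← mul_apply_eq_comp,
    add_mul, ← tensorMap_mul, ← tensorMap_mul, hGe₁, hGe₂, hQ₁, hQ₂]

/-- The tensor sum of a `(Λ₁, r₁)`-cuspidal and a `(Λ₂, r₂)`-cuspidal operator is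
`(Λ, r)`-cuspidal for all `r < min r₁ r₂`. -/
theorem IsCuspidal.tensorSum {K₁ : H₁ →ₗ.[ℂ] H₁} {K₂ : H₂ →ₗ.[ℂ] H₂} {r₁ r₂ : ℝ}
    (h₁ : IsCuspidal L₁ r₁ K₁) (h₂ : IsCuspidal L₂ r₂ K₂) {r : ℝ} (hr0 : 0 < r) (hr₁ : r < r₁)
    (hr₂ : r < r₂) :
    IsCuspidal (CuspidalOperator.tensorSum L₁ L₂) r (CuspidalOperator.tensorSum K₁ K₂) := by
  have hL₁ := h₁.selfAdjointGeOne
  have hL₂ := h₂.selfAdjointGeOne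
  obtain ⟨-, B₁, -, -, -, -, -, -, hB₁, -⟩ := h₁.exists_bounded
  obtain ⟨-, B₂, -, -, -, -, -, -, hB₂, -⟩ := h₂.exists_bounded
  have hd := denseRange_tensorMap_boundedInverse_add hL₁ hL₂
  have hb := boundedInverse_tensorSum_mul hL₁ hL₂
  obtain ⟨Z, hZ⟩ := exists_extension_tensorMap_add (B₁ := B₁) (B₂ := B₂)
    (boundedInverse_nonneg hL₁) (boundedInverse_nonneg hL₂) hd
  obtain ⟨C₁, hC₁, hest₁⟩ := h₁.exists_norm_tensorMap_rpow_le h₂ hr0 hr₁ hB₁ hB₂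
  obtain ⟨C₂, hC₂, hest₂⟩ := h₂.exists_norm_tensorMap_rpow_le h₁ hr0 hr₂ hB₂ hB₁
  have hm : ∀ (P : H₁ →L[ℂ] H₁) (Q : H₂ →L[ℂ] H₂) (g : HilbertTensor H₁ H₂),
      leftAmplification H₁ H₂ P (rightAmplification H₁ H₂ Q g) = tensorMap P Q g := by
    intro P Q g
    change tensorMap P 1 (tensorMap 1 Q g) = _
    rw [← mul_apply_eq_comp, ← tensorMap_mul, mul_one, one_mul]
  refine isCuspidal_of_commuting (isSelfAdjointGeOne_tensorSum hL₁ hL₂)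
    (isMaximalAccretive_tensorSum h₁.maximalAccretive h₂.maximalAccretive) hr0
    (hr₁.trans_le h₁.exponent_le_one)
    (mem_graph_tensorSum hL₁ hL₂
      (isClosable_algTensorSum h₁.maximalAccretive h₂.maximalAccretive) hB₁ hB₂ hZ)
    (fun p hp => mem_closure_of_mem_graph_tensorSum h₁ h₂ hB₁ hB₂ hZ hp)
    continuous_leftAmplification continuous_rightAmplification
    (boundedInverse_nonneg hL₁) (boundedInverse_nonneg hL₂) ?_ ?_ hd (C := max C₁ C₂)
    (hC₁.trans (le_max_left _ _)) (fun g t => ?_) (fun g t => ?_)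
  · change tensorMap _ 1 * tensorMap 1 _ = tensorMap 1 _ * tensorMap _ 1
    rw [← tensorMap_mul, ← tensorMap_mul, one_mul, mul_one, one_mul, mul_one]
  · refine hb.trans (ContinuousLinearMap.ext fun g => (hm _ _ g).symm)
  · change _ ≤ max C₁ C₂ * (‖Z (boundedTensorSum (boundedInverse L₁) (boundedInverse L₂) g) -
        (Complex.I * t) • boundedInverse _
          (boundedTensorSum (boundedInverse L₁) (boundedInverse L₂) g)‖ +
      ‖boundedInverse _ (boundedTensorSum (boundedInverse L₁) (boundedInverse L₂) g)‖)
    rw [hm, hZ, ← mul_apply_eq_comp (boundedInverse _), hb]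
    refine (hest₁ g t).trans ?_
    gcongr
    exact le_max_left _ _
  · change _ ≤ max C₁ C₂ * (‖Z (boundedTensorSum (boundedInverse L₁) (boundedInverse L₂) g) -
        (Complex.I * t) • boundedInverse _
          (boundedTensorSum (boundedInverse L₁) (boundedInverse L₂) g)‖ +
      ‖boundedInverse _ (boundedTensorSum (boundedInverse L₁) (boundedInverse L₂) g)‖)
    rw [hm, hZ, ← mul_apply_eq_comp (boundedInverse _), hb]
    -- The estimate for Λ₂ was obtained on H₂ ⊗ H₁ and is carried back by the isometric exchange of
    -- factors.
    have h := hest₂ (tensorSwap H₁ H₂ g) t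
    rw [add_apply, tensorMap_tensorSwap, tensorMap_tensorSwap, tensorMap_tensorSwap,
      tensorMap_tensorSwap, ← map_smul, ← map_add, ← map_sub, norm_tensorSwap, norm_tensorSwap,
      norm_tensorSwap, add_comm (tensorMap _ B₂ g)] at h
    refine h.trans ?_
    gcongr
    · exact le_max_right _ _
    · rfl

end TensorSumInverse

/-- Amounts to x ≤ 8 - 2x; it places the claimed exponents below min r₁ r₂. -/
theorem sq_div_le_self {x : ℝ} (h0 : 0 < x) (h1 : x ≤ 1) : x ^ 2 / (8 - 2 * x) ≤ x := by
  rw [div_le_iff₀ (by linarith)]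
  nlinarith

end CuspidalOperator

theorem proposition3p11
    {H₁ : Type*} [NormedAddCommGroup H₁] [InnerProductSpace ℂ H₁] [CompleteSpace H₁]
    {H₂ : Type*} [NormedAddCommGroup H₂] [InnerProductSpace ℂ H₂] [CompleteSpace H₂]
    (K₁ L₁ : H₁ →ₗ.[ℂ] H₁) (K₂ L₂ : H₂ →ₗ.[ℂ] H₂) (r₁ r₂ : ℝ)
    (h₁ : CuspidalOperator.IsCuspidal L₁ r₁ K₁) (h₂ : CuspidalOperator.IsCuspidal L₂ r₂ K₂)
    (r : ℝ) (hr_pos : 0 < r)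
    (hr : r < min (r₁ ^ 2 / (8 - 2 * r₁)) (r₂ ^ 2 / (8 - 2 * r₂))) :
    CuspidalOperator.IsCuspidal (CuspidalOperator.tensorSum L₁ L₂) r
      (CuspidalOperator.tensorSum K₁ K₂) :=
  h₁.tensorSum h₂ hr_pos
    ((lt_min_iff.1 hr).1.trans_le
      (CuspidalOperator.sq_div_le_self h₁.exponent_pos h₁.exponent_le_one))
    ((lt_min_iff.1 hr).2.trans_le
      (CuspidalOperator.sq_div_le_self h₂.exponent_pos h₂.exponent_le_one))
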